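/- **Setting.** Let $n\ge 3$ and fix a pole $\bar e\in\mathbb S^{n-1}$. A (Borel) measure $\mu$ on the unit sphere $\mathbb S^{n-1}\subset\mathbb R^n$ is *even* if it gives antipodal sets the same measure, *zonal* if it is invariant under the stabilizer $\mathrm{SO}(n-1)$ of $\bar e$ in $\mathrm{SO}(n)$, and *discrete* if it is concentrated on a countable set. A convex body is a nonempty compact convex set $K\subset\mathbb R^n$; $h(K,u)=\max\{u\cdot x:x\in K\}$ is its support function, $K^\circ=\{x: x\cdot y\le 1 \text{ for all } y\in K\}$ its polar body, and $|\cdot|$ denotes volume. For $1\le p<\infty$ put $$a_{n,p}=\frac{\Gamma\left(\frac{n+p}{2}\right)}{2\pi^{(n-1)/2}\,\Gamma\left(\frac{p+1}{2}\right)}.$$ Let $K$ be a convex body with the origin in its interior. Its surface area measure $S(K,\cdot)$ is the image of the $(n-1)$-dimensional Hausdorff measure on $\partial' K$ (the set of boundary points of $K$ with a unique outer unit normal) under the Gauss map $\nu_K:\partial'K\to\mathbb S^{n-1}$, and its $L_p$ surface area measure is $dS_p(K,\cdot)=h(K,\cdot)^{1-p}\,dS(K,\cdot)$. The $L_p$ projection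 body $\Pi_pK$ is the convex body with $$h(\Pi_pK,u)^p=a_{n,p}\int_{\mathbb S^{n-1}}|u\cdot v|^p\,dS_p(K,v),\qquad u\in\mathbb S^{n-1}.$$ For an even, zonal measure $\mu$, let $Z_p^\mu(\bar e)$ be the convex body with $h(Z_p^\mu(\bar e),u)^p=\int_{\mathbb S^{n-1}}|u\cdot v|^p\,d\mu(v)$ for $u\in\mathbb S^{n-1}$, let $Z_p^\mu(u)=\vartheta Z_p^\mu(\bar e)$ for any $\vartheta\in\mathrm{SO}(n)$ with $\vartheta\bar e=u$, and let $\Phi_p^\mu K$ be the convex body with $$h(\Phi_p^\mu K,u)^p=\int_{\mathbb S^{n-1}}h(Z_p^\mu(u),v)^p\,dS_p(K,v),\qquad u\in\mathbb S^{n-1}.$$ Write $\Pi_p^\circ K=(\Pi_pK)^\circ$ and $\Phi_p^{\mu,\circ}K=(\Phi_p^\mu K)^\circ$. **Theorem.** Let $n\ge3$ and $1\le p<\infty$. If $\mu$ is an even, zonal measure on $\mathbb S^{n-1}$ with $\mu(\mathbb S^{n-1})=a_{n,p}$ and $K\subset\mathbb R^n$ is a convex body containing the origin in its interior, then $$|\Phi_p^{\mu,\circ}K|\le|\Pi_p^\circ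 K|,$$ with equality if and only if $\mu$ is discrete or $\Pi_pK$ is a Euclidean ball. -/

import Mathlib

open Set MeasureTheory Metric
open scoped RealInnerProductSpace

noncomputable section

namespace LpIso

/-- Euclidean space `ℝⁿ`. -/
abbrev Rn (n : ℕ) : Type := EuclideanSpace ℝ (Fin n)

/-- The Euclidean unit sphere of `ℝⁿ`, with its Borel σ-algebra. -/
abbrev Sph (n : ℕ) : Type := sphere (0 : Rn n) 1

/-! ### Convex bodies: support functions, polars -/

/-- Support function `h(K, u) = max {u · x : x ∈ K}`. -/
def supportFn {n : ℕ} (K : Set (Rn n)) (u : Rn n) : ℝ :=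
  sSup ((fun x : Rn n => ⟪u, x⟫) '' K)

/-- Polar body `K° = {x : x · y ≤ 1 for all y ∈ K}`. -/
def polarBody {n : ℕ} (K : Set (Rn n)) : Set (Rn n) :=
  {x | ∀ y ∈ K, ⟪x, y⟫ ≤ 1}

/-- The convex body whose support function restricted to the sphere is `f`. A convex body is the
intersection of its supporting half-spaces, so whenever `f` is (the restriction to the sphere of)
a support function, this intersection of half-spaces is the unique convex body with support
function `f`. -/
def bodyOfSupport {n : ℕ} (f : Sph n → ℝ) : Set (Rn n) :=
  {x | ∀ u : Sph n, ⟪(u : Rn n), x⟫ ≤ f u}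

/-! ### Rotations, and measures on the sphere -/

/-- `ϑ` belongs to `SO(n)`. -/
def IsRotation {n : ℕ} (ϑ : Rn n ≃ₗᵢ[ℝ] Rn n) : Prop :=
  LinearMap.det (ϑ.toLinearEquiv : Rn n →ₗ[ℝ] Rn n) = 1

/-- The action of a linear isometry on the unit sphere. -/
def sphereMap {n : ℕ} (ϑ : Rn n ≃ₗᵢ[ℝ] Rn n) (v : Sph n) : Sph n :=
  ⟨ϑ v, by simp⟩

/-- `μ` is even: antipodal sets have the same measure. -/
def IsEvenMeasure {n : ℕ} (μ : Measure (Sph n)) : Prop :=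
  μ.map (fun v => -v) = μ

/-- `μ` is zonal with pole `e`: it is invariant under the stabilizer `SO(n-1)` of `e` in
`SO(n)`. -/
def IsZonalMeasure {n : ℕ} (e : Sph n) (μ : Measure (Sph n)) : Prop :=
  ∀ ϑ : Rn n ≃ₗᵢ[ℝ] Rn n, IsRotation ϑ → sphereMap ϑ e = e → μ.map (sphereMap ϑ) = μ

/-- `μ` is discrete: it is concentrated on a countable set. -/
def IsDiscreteMeasure {n : ℕ} (μ : Measure (Sph n)) : Prop :=
  ∃ s : Set (Sph n), s.Countable ∧ μ sᶜ = 0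

/-! ### Surface area measures -/

/-- `u` is an outer unit normal of `K` at `x`. -/
def IsOuterNormal {n : ℕ} (K : Set (Rn n)) (x : Rn n) (u : Sph n) : Prop :=
  ∀ y ∈ K, ⟪(u : Rn n), y⟫ ≤ ⟪(u : Rn n), x⟫

/-- The set `∂'K` of those boundary points of `K` that have a unique outer unit normal. -/
def regularBoundary {n : ℕ} (K : Set (Rn n)) : Set (Rn n) :=
  {x | x ∈ frontier K ∧ ∃! u : Sph n, IsOuterNormal K x u}

/-- The Gauss map `ν_K : ∂'K → 𝕊ⁿ⁻¹`. -/
def gaussMap {n : ℕ} (K : Set (Rn n)) (x : regularBoundary K) : Sph n :=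
  x.2.2.choose

/-- The surface area measure `S(K, ·)`: the image under the Gauss map of the `(n-1)`-dimensional
Hausdorff measure on `∂'K`. (`μHE` is the Hausdorff measure in its usual normalization, in which it
agrees with Lebesgue measure on `(n-1)`-dimensional subspaces.) -/
def surfaceAreaMeasure {n : ℕ} (K : Set (Rn n)) : Measure (Sph n) :=
  ((μHE[n - 1] : Measure (Rn n)).comap (Subtype.val : regularBoundary K → Rn n)).map (gaussMap K)

/-- The `L_p` surface area measure `S_p(K, ·)`, with density `h(K, ·)^(1-p)` with respect to
`S(K, ·)`. -/
def lpSurfaceAreaMeasure {n : ℕ} (p : ℝ) (K : Set (Rn n)) : Measure (Sph n) :=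
  (surfaceAreaMeasure K).withDensity fun v => ENNReal.ofReal (supportFn K v ^ (1 - p))

/-! ### `L_p` projection bodies, `L_p` zonoids and the operators `Φ_p^μ` -/

/-- The constant `a_{n,p} = Γ((n+p)/2) / (2 π^((n-1)/2) Γ((p+1)/2))`. -/
def aConst (n : ℕ) (p : ℝ) : ℝ :=
  Real.Gamma ((n + p) / 2) / (2 * Real.pi ^ (((n : ℝ) - 1) / 2) * Real.Gamma ((p + 1) / 2))

/-- The `L_p` projection body `Π_p K`:
`h(Π_p K, u)^p = a_{n,p} ∫ |u · v|^p dS_p(K, v)`. -/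
def lpProjectionBody {n : ℕ} (p : ℝ) (K : Set (Rn n)) : Set (Rn n) :=
  bodyOfSupport fun u =>
    (aConst n p * ∫ v : Sph n, |⟪(u : Rn n), (v : Rn n)⟫| ^ p ∂(lpSurfaceAreaMeasure p K)) ^ (1 / p)

/-- The `L_p` zonoid `Z_p^μ` generated by `μ`: `h(Z_p^μ, u)^p = ∫ |u · v|^p dμ(v)`. -/
def lpZonoid {n : ℕ} (p : ℝ) (μ : Measure (Sph n)) : Set (Rn n) :=
  bodyOfSupport fun u => (∫ v : Sph n, |⟪(u : Rn n), (v : Rn n)⟫| ^ p ∂μ) ^ (1 / p)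

/-- The rotated copy `Z_p^μ(u) = ϑ Z_p^μ` of `Z_p^μ = Z_p^μ(e)`, where `ϑ ∈ SO(n)` and `ϑ e = u`.
For zonal `μ` with pole `e` all these rotations give the same body, which is thus also their
union. -/
def lpZonoidAt {n : ℕ} (p : ℝ) (e : Sph n) (μ : Measure (Sph n)) (u : Sph n) : Set (Rn n) :=
  {x | ∃ ϑ : Rn n ≃ₗᵢ[ℝ] Rn n, IsRotation ϑ ∧ sphereMap ϑ e = u ∧ x ∈ ϑ '' lpZonoid p μ}

/-- The body `Φ_p^μ K`: `h(Φ_p^μ K, u)^p = ∫ h(Z_p^μ(u), v)^p dS_p(K, v)`. -/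
def phiBody {n : ℕ} (p : ℝ) (e : Sph n) (μ : Measure (Sph n)) (K : Set (Rn n)) : Set (Rn n) :=
  bodyOfSupport fun u =>
    (∫ v : Sph n, supportFn (lpZonoidAt p e μ u) v ^ p ∂(lpSurfaceAreaMeasure p K)) ^ (1 / p)

/-- `B` is a Euclidean ball (of positive radius). -/
def IsEuclideanBall {n : ℕ} (B : Set (Rn n)) : Prop :=
  ∃ (c : Rn n) (r : ℝ), 0 < r ∧ B = closedBall c r

end LpIso

end

noncomputable section

namespace LpIso

/-! ### Seminorms and the bodies they support -/

/-! The support functions involved are even, so they are treated as seminorms: `F` for `Π_p K` and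
`H` for `Φ_p^μ K`. Polar bodies are then unit balls, and in polar coordinates their volumes are the
integrals of `F⁻ⁿ` and `H⁻ⁿ` over the sphere, divided by `n` (`polarBody_bodyOfSupport`,
`volume_seminorm_le_one`).

The value `h(Z_p^μ(u), v)` depends only on the angle between `u` and `v`, because `μ` is zonal.
Exchanging `u` and `v` and applying Fubini (`zonoidSeminorm_eq`, `phiSeminorm_rpow`) shows that, for
every rotation `ϑ`, `H(ϑ e)^p` is the `μ`-average of `w ↦ F(ϑ w)^p`; the total mass `a_{n,p}` is
what makes it an average. Jensen's inequality for the strictly convex function `t ↦ t^(-n/p)` bounds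
`H(ϑ e)⁻ⁿ` by the average of `F(ϑ w)⁻ⁿ`. Integration over `SO(n)` removes the dependence on `w` and
gives the inequality (`integral_rotationHaar_inv_pow_le`).

In the equality case, `F(ϑ w) = H(ϑ e)` for every `ϑ` and `μ`-almost every `w`. A finite zonal
measure is discrete exactly when it lives on the poles `±e`, since any other atom would bring along
a whole latitude of equal atoms. If `μ` is not discrete, its support contains some `w ≠ ±e`, and
then `F(u)` is determined by any `x` at a fixed angle from `u`, an angle different from `0` and `π`.
Nearby points share such an `x`, so `F` is locally constant, hence constant
(`eq_of_forall_inner_eq`). Conversely, in both listed cases the averages are trivial and `H = F`.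

All this needs `S_p(K, ·)` to be finite and `F` to be positive. Finiteness holds because orthogonal
projection is bi-Lipschitz on boundary pieces with nearly parallel normals; positivity holds
because, by Rademacher's theorem for the gauge, `S(K, ·)` is not concentrated on a great subsphere.
-/

theorem continuous_seminorm {n : ℕ} (s : Seminorm ℝ (Rn n)) : Continuous s := by
  have h := (s.convexOn.continuousOn isOpen_univ)
  exact continuousOn_univ.1 h

theorem seminorm_smul_of_nonneg {E : Type*} [AddCommGroup E] [Module ℝ E] (s : Seminorm ℝ E)
    {c : ℝ} (hc : 0 ≤ c) (x : E) : s (c • x) = c * s x := by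
  rw [map_smul_eq_mul, Real.norm_of_nonneg hc]

/-- A nonzero vector is the product of its norm and a unit vector. -/
theorem exists_eq_norm_smul {n : ℕ} {x : Rn n} (hx : x ≠ 0) : ∃ u : Sph n, x = ‖x‖ • (u : Rn n) :=
  ⟨⟨‖x‖⁻¹ • x, by simp [norm_smul, norm_ne_zero_iff.2 hx]⟩, by
    simp [smul_smul, norm_ne_zero_iff.2 hx]⟩

/-- A seminorm is the supremum of the linear functionals that it dominates. -/
theorem exists_inner_eq_seminorm {n : ℕ} (s : Seminorm ℝ (Rn n)) (x : Rn n) :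
    ∃ y : Rn n, ⟪x, y⟫ = s x ∧ ∀ z, ⟪z, y⟫ ≤ s z := by
  rcases eq_or_ne x 0 with rfl | hx
  · exact ⟨0, by simp, fun z => by simp⟩
  let f : Module.Dual ℝ (ℝ ∙ x) :=
    s x • (LinearEquiv.toSpanNonzeroSingleton ℝ (Rn n) x hx).symm.toLinearMap
  obtain ⟨g, hg, hgs⟩ := Module.Dual.exists_extension_of_le_seminorm_real (ℝ ∙ x) f (p := s) (by
    rintro ⟨y, hy⟩
    obtain ⟨c, rfl⟩ := Submodule.mem_span_singleton.1 hy
    have : (LinearEquiv.toSpanNonzeroSingleton ℝ (Rn n) x hx).symm ⟨c • x, hy⟩ = c := by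
      rw [LinearEquiv.symm_apply_eq]; rfl
    simp only [f, LinearMap.smul_apply, LinearEquiv.coe_coe, this, smul_eq_mul, map_smul_eq_mul]
    rw [mul_comm]
    exact mul_le_mul_of_nonneg_right (le_abs_self c) (apply_nonneg s x))
  refine ⟨(InnerProductSpace.toDual ℝ (Rn n)).symm (LinearMap.toContinuousLinearMap g), ?_, ?_⟩
  · rw [real_inner_comm, InnerProductSpace.toDual_symm_apply]
    have h1 := hg ⟨x, Submodule.mem_span_singleton_self x⟩
    have : (LinearEquiv.toSpanNonzeroSingleton ℝ (Rn n) x hx).symm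
        ⟨x, Submodule.mem_span_singleton_self x⟩ = 1 := by
      rw [LinearEquiv.symm_apply_eq, LinearEquiv.toSpanNonzeroSingleton_one]
    simp only [f, LinearMap.smul_apply, LinearEquiv.coe_coe, this, smul_eq_mul, mul_one] at h1
    simpa using h1
  · intro z
    rw [real_inner_comm, InnerProductSpace.toDual_symm_apply]
    exact (le_abs_self _).trans (hgs z)

theorem mem_bodyOfSupport_iff {n : ℕ} (s : Seminorm ℝ (Rn n)) {x : Rn n} :
    x ∈ bodyOfSupport (fun u : Sph n => s u) ↔ ∀ z, ⟪z, x⟫ ≤ s z := by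
  refine ⟨fun h z => ?_, fun h u => h u⟩
  rcases eq_or_ne z 0 with rfl | hz
  · simp
  obtain ⟨u, hu⟩ := exists_eq_norm_smul hz
  rw [hu, real_inner_smul_left, seminorm_smul_of_nonneg s (norm_nonneg z)]
  exact mul_le_mul_of_nonneg_left (h u) (norm_nonneg z)

theorem supportFn_bodyOfSupport {n : ℕ} (s : Seminorm ℝ (Rn n)) (x : Rn n) :
    supportFn (bodyOfSupport (fun u : Sph n => s u)) x = s x := by
  obtain ⟨y, hy, hys⟩ := exists_inner_eq_seminorm s x
  have : IsGreatest ((fun y : Rn n => ⟪x, y⟫) '' bodyOfSupport (fun u : Sph n => s u)) (s x) := by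
    refine ⟨⟨y, (mem_bodyOfSupport_iff s).2 hys, hy⟩, ?_⟩
    rintro _ ⟨z, hz, rfl⟩
    exact (mem_bodyOfSupport_iff s).1 hz x
  exact this.csSup_eq

/-- The nontrivial inclusion uses Hahn–Banach: some point of the body attains the value `s x`. -/
theorem polarBody_bodyOfSupport {n : ℕ} (s : Seminorm ℝ (Rn n)) :
    polarBody (bodyOfSupport (fun u : Sph n => s u)) = {x | s x ≤ 1} := by
  ext x
  constructor
  · intro h
    obtain ⟨y, hy, hys⟩ := exists_inner_eq_seminorm s x
    exact hy.ge.trans (h y ((mem_bodyOfSupport_iff s).2 hys))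
  · intro h y hy
    exact ((mem_bodyOfSupport_iff s).1 hy x).trans h

/-- A ball with centre `c` and radius `r` has support function `u ↦ u · c + r`; evenness of a
seminorm, compared at `u` and `-u`, eliminates the linear term. -/
theorem isEuclideanBall_bodyOfSupport_iff {n : ℕ} (s : Seminorm ℝ (Rn n))
    (hs : ∀ u : Sph n, 0 < s u) (e : Sph n) :
    IsEuclideanBall (bodyOfSupport (fun u : Sph n => s u)) ↔ ∃ r, ∀ u : Sph n, s u = r := by
  constructor
  · rintro ⟨c, r, hr, h⟩
    have key : ∀ u : Sph n, s u = ⟪(u : Rn n), c⟫ + r := by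
      intro u
      have hu : ‖(u : Rn n)‖ = 1 := by simp
      rw [← supportFn_bodyOfSupport s, h]
      refine IsGreatest.csSup_eq ⟨⟨c + r • (u : Rn n), ?_, ?_⟩, ?_⟩
      · simp [norm_smul, abs_of_pos hr]
      · simp [inner_add_right, real_inner_smul_right, hu]
      · rintro _ ⟨z, hz, rfl⟩
        have h1 := real_inner_le_norm (u : Rn n) (z - c)
        rw [mem_closedBall, dist_eq_norm] at hz
        rw [inner_sub_right, hu] at h1
        simp only
        linarith
    refine ⟨r, fun u => ?_⟩
    have h1 := key u
    have h2 := key (-u)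
    simp only [coe_neg_sphere, map_neg_eq_map, inner_neg_left] at h2
    linarith
  · rintro ⟨r, hr⟩
    refine ⟨0, r, hr e ▸ hs e, ?_⟩
    have hr0 : 0 < r := hr e ▸ hs e
    ext x
    simp only [bodyOfSupport, hr, mem_ofPred_eq, mem_closedBall, dist_zero_right]
    constructor
    · intro h
      rcases eq_or_ne x 0 with rfl | hx
      · simpa using hr0.le
      obtain ⟨u, hu⟩ := exists_eq_norm_smul hx
      have := h u
      nth_rewrite 1 [hu] at this
      rwa [real_inner_smul_right, real_inner_self_eq_norm_sq, norm_eq_of_mem_sphere, one_pow,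
        mul_one] at this
    · intro h u
      have := real_inner_le_norm (u : Rn n) x
      rw [norm_eq_of_mem_sphere, one_mul] at this
      exact this.trans h

/-! ### `L_p` means of seminorms and the `L_p` cosine transform -/

/-- The `L_p` mean of a family of seminorms. -/
def lpMean {E Ω : Type*} [AddCommGroup E] [Module ℝ E] [MeasurableSpace Ω] (p : ℝ) (hp : 1 ≤ p)
    (ν : Measure Ω) (N : Ω → Seminorm ℝ E) (hN : ∀ x, MemLp (fun v => N v x) (ENNReal.ofReal p) ν) :
    Seminorm ℝ E :=
  have hp0 : 0 < p := by linarith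
  -- Written as an `L^p` norm, the mean inherits subadditivity from Minkowski's inequality.
  have key : ∀ f : Ω → ℝ, (∀ v, 0 ≤ f v) → MemLp f (ENNReal.ofReal p) ν →
      (∫ v, f v ^ p ∂ν) ^ (1 / p) = (eLpNorm f (ENNReal.ofReal p) ν).toReal := by
    intro f hf hfp
    rw [hfp.eLpNorm_eq_integral_rpow_norm (by simpa using hp0) (by simp),
      ENNReal.toReal_ofReal (by positivity), ENNReal.toReal_ofReal hp0.le, one_div]
    simp only [Real.norm_of_nonneg (hf _)]
  Seminorm.of (fun x => (∫ v, N v x ^ p ∂ν) ^ (1 / p))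
    (fun x y => by
      rw [key _ (fun v => apply_nonneg _ _) (hN _), key _ (fun v => apply_nonneg _ _) (hN _),
        key _ (fun v => apply_nonneg _ _) (hN _),
        ← ENNReal.toReal_add (hN x).eLpNorm_ne_top (hN y).eLpNorm_ne_top]
      refine ENNReal.toReal_mono
        (ENNReal.add_ne_top.2 ⟨(hN x).eLpNorm_ne_top, (hN y).eLpNorm_ne_top⟩) ?_
      refine le_trans (eLpNorm_mono_real (g := (fun v => N v x) + fun v => N v y) fun v => ?_)
        (eLpNorm_add_le (hN x).1 (hN y).1 (by simpa using ENNReal.ofReal_le_ofReal hp))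
      rw [Real.norm_of_nonneg (apply_nonneg _ _)]
      exact map_add_le_add (N v) x y)
    (fun c x => by
      simp only [map_smul_eq_mul]
      simp_rw [Real.mul_rpow (norm_nonneg c) (apply_nonneg _ _)]
      rw [integral_const_mul, Real.mul_rpow (by positivity)
        (integral_nonneg fun v => Real.rpow_nonneg (apply_nonneg _ _) _), ← Real.rpow_mul
          (norm_nonneg c), mul_one_div_cancel hp0.ne', Real.rpow_one])

theorem lpMean_apply {E Ω : Type*} [AddCommGroup E] [Module ℝ E] [MeasurableSpace Ω] {p : ℝ}
    (hp : 1 ≤ p) (ν : Measure Ω) (N : Ω → Seminorm ℝ E)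
    (hN : ∀ x, MemLp (fun v => N v x) (ENNReal.ofReal p) ν) (x : E) :
    lpMean p hp ν N hN x = (∫ v, N v x ^ p ∂ν) ^ (1 / p) :=
  rfl

/-- A continuous function on the sphere lies in every `L^p` space of a finite measure. -/
theorem memLp_of_continuous {n : ℕ} {f : Sph n → ℝ} (hf : Continuous f) (ν : Measure (Sph n))
    [IsFiniteMeasure ν] (q : ENNReal) : MemLp f q ν := by
  obtain ⟨C, hC⟩ := isCompact_univ.exists_bound_of_continuousOn hf.continuousOn
  exact MemLp.of_bound hf.aestronglyMeasurable C (ae_of_all _ fun v => hC v (mem_univ v))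

theorem integrable_of_continuous {X : Type*} [TopologicalSpace X] [CompactSpace X]
    [MeasurableSpace X] [BorelSpace X] {f : X → ℝ} (hf : Continuous f) (ν : Measure X)
    [IsFiniteMeasure ν] : Integrable f ν :=
  (BoundedContinuousFunction.mkOfCompact ⟨f, hf⟩).integrable ν

/-- The seminorm `x ↦ |x · v|`. -/
def absInner {n : ℕ} (v : Rn n) : Seminorm ℝ (Rn n) :=
  Seminorm.of (fun x => |⟪x, v⟫|) (fun x y => by rw [inner_add_left]; exact abs_add_le _ _)
    (fun c x => by rw [real_inner_smul_left, abs_mul, Real.norm_eq_abs])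

/-- The seminorm `x ↦ (∫ |x · v|^p dν(v))^(1/p)`. -/
def lpCosine {n : ℕ} (p : ℝ) (hp : 1 ≤ p) (ν : Measure (Sph n)) [IsFiniteMeasure ν] :
    Seminorm ℝ (Rn n) :=
  lpMean p hp ν (fun v : Sph n => absInner (v : Rn n))
    (fun x => memLp_of_continuous (f := fun v : Sph n => |⟪x, (v : Rn n)⟫|) (by fun_prop) ν _)

theorem lpCosine_apply {n : ℕ} {p : ℝ} (hp : 1 ≤ p) (ν : Measure (Sph n)) [IsFiniteMeasure ν]
    (x : Rn n) : lpCosine p hp ν x = (∫ v : Sph n, |⟪x, (v : Rn n)⟫| ^ p ∂ν) ^ (1 / p) :=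
  rfl

theorem lpCosine_rpow {n : ℕ} {p : ℝ} (hp : 1 ≤ p) (ν : Measure (Sph n)) [IsFiniteMeasure ν]
    (x : Rn n) : lpCosine p hp ν x ^ p = ∫ v : Sph n, |⟪x, (v : Rn n)⟫| ^ p ∂ν := by
  rw [lpCosine_apply, ← Real.rpow_mul (integral_nonneg fun v => by positivity),
    one_div_mul_cancel (by linarith), Real.rpow_one]

/-! ### Volume of the unit ball of a norm -/

/-- In polar coordinates the ray in direction `u` meets the open unit ball in `(0, 1 / s u)`, whose
mass for `t^(n-1) dt` is `(s u)⁻ⁿ / n`. -/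
theorem volume_seminorm_le_one {n : ℕ} (hn : 1 ≤ n) (s : Seminorm ℝ (Rn n))
    (hs : ∀ u : Sph n, 0 < s u) :
    volume {x | s x ≤ 1} =
      ENNReal.ofReal ((∫ u : Sph n, (s u)⁻¹ ^ n ∂(volume : Measure (Rn n)).toSphere) / n) := by
  have hcont := continuous_seminorm s
  have : Nonempty (Fin n) := ⟨⟨0, hn⟩⟩
  have : Nontrivial (Rn n) := inferInstance
  -- The unit sphere of a norm is null, so the open ball may be measured instead.
  have hfr : volume {x | s x ≤ 1} = volume {x | s x < 1} := by
    refine measure_le_eq_lt (volume : Measure (Rn n)) (g := s) (map_zero s)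
      (fun x => map_neg_eq_map s x) (fun x y => map_add_le_add s x y) (fun {x} hx => ?_)
      (fun r x => (map_smul_eq_mul s r x).le) 1
    by_contra hx0
    obtain ⟨u, hu⟩ := exists_eq_norm_smul hx0
    rw [hu, seminorm_smul_of_nonneg s (norm_nonneg x)] at hx
    exact (mul_pos (norm_pos_iff.2 hx0) (hs u)).ne' hx
  have hmp := Measure.measurePreserving_homeomorphUnitSphereProd (volume : Measure (Rn n))
  have hS : MeasurableSet {q : Sph n × Ioi (0 : ℝ) | (q.2 : ℝ) < (s q.1)⁻¹} := by
    refine measurableSet_lt (by fun_prop) ?_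
    exact (((hcont.measurable.comp measurable_subtype_coe).comp measurable_fst)).inv
  have h1 : volume {x | s x < 1} = ((volume : Measure (Rn n)).toSphere.prod
      (Measure.volumeIoiPow (Module.finrank ℝ (Rn n) - 1)))
        {q : Sph n × Ioi (0 : ℝ) | (q.2 : ℝ) < (s q.1)⁻¹} := by
    rw [← hmp.measure_preimage hS.nullMeasurableSet, comap_subtype_coe_apply
      (measurableSet_singleton _).compl]
    rw [← measure_sdiff_null (s := {x | s x < 1}) (measure_singleton (0 : Rn n))]
    congr 1
    ext x
    constructor
    · rintro ⟨hx, hx0⟩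
      refine ⟨⟨x, hx0⟩, ?_, rfl⟩
      have hx0 : x ≠ 0 := hx0
      have hn0 : 0 < ‖x‖ := norm_pos_iff.2 hx0
      simp only [mem_preimage, mem_ofPred_eq, homeomorphUnitSphereProd_apply_snd_coe,
        homeomorphUnitSphereProd_apply_fst_coe]
      rw [seminorm_smul_of_nonneg s (by positivity), mul_inv, inv_inv]
      have hsx : 0 < s x := by
        obtain ⟨u, hu⟩ := exists_eq_norm_smul hx0
        rw [hu, seminorm_smul_of_nonneg s (norm_nonneg x)]
        exact mul_pos hn0 (hs u)
      have : 1 < (s x)⁻¹ := (one_lt_inv₀ hsx).2 hx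
      nlinarith
    · rintro ⟨⟨y, hy0⟩, hy, rfl⟩
      refine ⟨?_, hy0⟩
      have hy0 : y ≠ 0 := hy0
      have hn0 : 0 < ‖y‖ := norm_pos_iff.2 hy0
      simp only [mem_preimage, mem_ofPred_eq, homeomorphUnitSphereProd_apply_snd_coe,
        homeomorphUnitSphereProd_apply_fst_coe] at hy
      rw [seminorm_smul_of_nonneg s (by positivity), mul_inv, inv_inv] at hy
      have hsx : 0 < s y := by
        obtain ⟨u, hu⟩ := exists_eq_norm_smul hy0
        rw [hu, seminorm_smul_of_nonneg s (norm_nonneg y)]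
        exact mul_pos hn0 (hs u)
      have : 1 < (s y)⁻¹ := by
        by_contra! h
        nlinarith
      exact (one_lt_inv₀ hsx).1 this
  have hcinv : Continuous fun u : Sph n => (s u)⁻¹ ^ n / (n : ℝ) :=
    (((hcont.comp continuous_subtype_val).inv₀ fun u => (hs u).ne').pow n).div_const _
  rw [hfr, h1, Measure.prod_apply hS, ← integral_div,
    ofReal_integral_eq_lintegral_ofReal (integrable_of_continuous hcinv _)
      (ae_of_all _ fun u => by have := hs u; positivity)]
  refine lintegral_congr fun u => ?_
  have hpos := inv_pos.2 (hs u)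
  have : Prod.mk u ⁻¹' {q : Sph n × Ioi (0 : ℝ) | (q.2 : ℝ) < (s q.1)⁻¹} =
      Iio (⟨(s u)⁻¹, hpos⟩ : Ioi (0 : ℝ)) := by
    ext t
    simp [← Subtype.coe_lt_coe]
  rw [this, Measure.volumeIoiPow_apply_Iio]
  simp [Nat.sub_add_cancel hn, Nat.cast_sub hn]

/-! ### Rotations -/

theorem IsRotation.trans {n : ℕ} {ϑ ρ : Rn n ≃ₗᵢ[ℝ] Rn n} (h : IsRotation ϑ) (h' : IsRotation ρ) :
    IsRotation (ϑ.trans ρ) := by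
  have : ((ϑ.trans ρ).toLinearEquiv : Rn n →ₗ[ℝ] Rn n) =
      (ρ.toLinearEquiv : Rn n →ₗ[ℝ] Rn n) ∘ₗ (ϑ.toLinearEquiv : Rn n →ₗ[ℝ] Rn n) := rfl
  rw [IsRotation, this, LinearMap.det_comp, h, h', mul_one]

theorem IsRotation.symm {n : ℕ} {ϑ : Rn n ≃ₗᵢ[ℝ] Rn n} (h : IsRotation ϑ) :
    IsRotation ϑ.symm := by
  have h2 : LinearMap.det ((ϑ.symm.toLinearEquiv : Rn n →ₗ[ℝ] Rn n) ∘ₗ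
      (ϑ.toLinearEquiv : Rn n →ₗ[ℝ] Rn n)) = 1 := by
    rw [show (ϑ.symm.toLinearEquiv : Rn n →ₗ[ℝ] Rn n) ∘ₗ (ϑ.toLinearEquiv : Rn n →ₗ[ℝ] Rn n) =
      LinearMap.id from LinearMap.ext fun x => ϑ.symm_apply_apply x, LinearMap.det_id]
  rw [LinearMap.det_comp, show LinearMap.det (ϑ.toLinearEquiv : Rn n →ₗ[ℝ] Rn n) = 1 from h,
    mul_one] at h2
  exact h2

/-- The linear isometry that maps `x` to `y` and fixes the vectors with equal inner products
against `x` and `y`. -/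
theorem exists_isometry_map_eq {n : ℕ} {x y : Rn n} (h : ‖x‖ = ‖y‖) :
    ∃ ρ : Rn n ≃ₗᵢ[ℝ] Rn n, ρ x = y ∧ ∀ z, ⟪x, z⟫ = ⟪y, z⟫ → ρ z = z := by
  refine ⟨(ℝ ∙ (x - y))ᗮ.reflection, Submodule.reflection_sub h, fun z hz => ?_⟩
  refine Submodule.reflection_mem_subspace_eq_self ?_
  rw [Submodule.mem_orthogonal_singleton_iff_inner_right, inner_sub_left, hz, sub_self]

theorem det_isometry_eq_or {n : ℕ} (ρ : Rn n ≃ₗᵢ[ℝ] Rn n) :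
    LinearMap.det (ρ.toLinearEquiv : Rn n →ₗ[ℝ] Rn n) = 1 ∨
      LinearMap.det (ρ.toLinearEquiv : Rn n →ₗ[ℝ] Rn n) = -1 := by
  have h := LinearIsometry.normDet_eq_one ρ.toLinearIsometry
  rw [LinearMap.normDet_eq_abs_det] at h
  exact (abs_eq zero_le_one).1 h

theorem exists_ne_zero_inner_eq_zero {n : ℕ} (hn : 3 ≤ n) (x y : Rn n) :
    ∃ z : Rn n, z ≠ 0 ∧ ⟪x, z⟫ = 0 ∧ ⟪y, z⟫ = 0 := by
  let f : Rn n →ₗ[ℝ] (Fin 2 → ℝ) :=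
    LinearMap.pi ![(innerSL ℝ x).toLinearMap, (innerSL ℝ y).toLinearMap]
  have hker : LinearMap.ker f ≠ ⊥ := by
    refine LinearMap.ker_ne_bot_of_finrank_lt ?_
    simp only [Module.finrank_fintype_fun_eq_card, Fintype.card_fin, finrank_euclideanSpace]
    omega
  obtain ⟨z, hz, hz0⟩ := Submodule.exists_mem_ne_zero_of_ne_bot hker
  exact ⟨z, hz0, congrFun hz 0, congrFun hz 1⟩

/-- For `n ≥ 3` the group `SO(n)` acts transitively on pairs of vectors with given norms and given
inner product. -/
theorem exists_rotation_map_pair {n : ℕ} (hn : 3 ≤ n) {x y x' y' : Rn n} (hx : ‖x‖ = ‖x'‖)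
    (hy : ‖y‖ = ‖y'‖) (hxy : ⟪x, y⟫ = ⟪x', y'⟫) :
    ∃ ϑ : Rn n ≃ₗᵢ[ℝ] Rn n, IsRotation ϑ ∧ ϑ x = x' ∧ ϑ y = y' := by
  obtain ⟨ρ₁, h₁, -⟩ := exists_isometry_map_eq hx
  have hn1 : ‖ρ₁ y‖ = ‖y'‖ := by rw [ρ₁.norm_map, hy]
  obtain ⟨ρ₂, h₂, h₂'⟩ := exists_isometry_map_eq hn1
  have hfix : ρ₂ x' = x' := by
    refine h₂' _ ?_
    nth_rewrite 1 [← h₁]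
    rw [ρ₁.inner_map_map, real_inner_comm, hxy, real_inner_comm]
  -- If the composite of the two isometries has determinant `-1`, a reflection that fixes `x'` and
  -- `y'` corrects it; the dimension leaves room for its normal `z`.
  obtain ⟨z, hz, hxz, hyz⟩ := exists_ne_zero_inner_eq_zero hn x' y'
  let ρ₃ : Rn n ≃ₗᵢ[ℝ] Rn n := (ℝ ∙ z)ᗮ.reflection
  have hρ₃ : LinearMap.det (ρ₃.toLinearEquiv : Rn n →ₗ[ℝ] Rn n) = -1 := by
    refine ((ℝ ∙ z)ᗮ.det_reflection).trans ?_
    rw [Submodule.orthogonal_orthogonal, finrank_span_singleton hz, pow_one]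
  have h₃ : ∀ w : Rn n, ⟪w, z⟫ = 0 → ρ₃ w = w := fun w hw =>
    Submodule.reflection_mem_subspace_eq_self
      (by rwa [Submodule.mem_orthogonal_singleton_iff_inner_left])
  rcases det_isometry_eq_or (ρ₁.trans ρ₂) with h | h
  · exact ⟨ρ₁.trans ρ₂, h, by simp [h₁, hfix], by simp [h₂]⟩
  · refine ⟨(ρ₁.trans ρ₂).trans ρ₃, ?_, by simp [h₁, hfix, h₃ _ hxz], by simp [h₂, h₃ _ hyz]⟩
    have : (((ρ₁.trans ρ₂).trans ρ₃).toLinearEquiv : Rn n →ₗ[ℝ] Rn n) =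
      (ρ₃.toLinearEquiv : Rn n →ₗ[ℝ] Rn n) ∘ₗ
        ((ρ₁.trans ρ₂).toLinearEquiv : Rn n →ₗ[ℝ] Rn n) := rfl
    rw [IsRotation, this, LinearMap.det_comp, h, hρ₃]
    norm_num

theorem exists_rotation_map_eq {n : ℕ} (hn : 3 ≤ n) (u v : Sph n) :
    ∃ ϑ : Rn n ≃ₗᵢ[ℝ] Rn n, IsRotation ϑ ∧ sphereMap ϑ u = v := by
  obtain ⟨ϑ, h, h1, -⟩ := exists_rotation_map_pair hn (x := u) (x' := v) (y := 0) (y' := 0)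
    (by simp) rfl (by simp)
  exact ⟨ϑ, h, Subtype.ext h1⟩

theorem continuous_sphereMap {n : ℕ} (ϑ : Rn n ≃ₗᵢ[ℝ] Rn n) : Continuous (sphereMap ϑ) :=
  (ϑ.continuous.comp continuous_subtype_val).subtype_mk _

theorem sphereMap_trans {n : ℕ} (ϑ ρ : Rn n ≃ₗᵢ[ℝ] Rn n) (v : Sph n) :
    sphereMap (ϑ.trans ρ) v = sphereMap ρ (sphereMap ϑ v) := rfl

theorem sphereMap_symm_apply {n : ℕ} (ϑ : Rn n ≃ₗᵢ[ℝ] Rn n) (v : Sph n) :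
    sphereMap ϑ.symm (sphereMap ϑ v) = v := Subtype.ext (ϑ.symm_apply_apply _)

open scoped Pointwise in
theorem toSphere_map_sphereMap {n : ℕ} (ϑ : Rn n ≃ₗᵢ[ℝ] Rn n) :
    (volume : Measure (Rn n)).toSphere.map (sphereMap ϑ) = (volume : Measure (Rn n)).toSphere := by
  ext s hs
  rw [Measure.map_apply (continuous_sphereMap ϑ).measurable hs, Measure.toSphere_apply' _ hs,
    Measure.toSphere_apply' _ ((continuous_sphereMap ϑ).measurable hs)]
  congr 1
  have hmp := ϑ.measurePreserving
  rw [← (MeasurePreserving.measure_preimage_equiv (f := ϑ.toHomeomorph.toMeasurableEquiv) hmp)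
    (Ioo (0 : ℝ) 1 • (Subtype.val '' s : Set (Rn n)))]
  congr 1
  ext x
  simp only [mem_smul, mem_image, mem_preimage]
  constructor
  · rintro ⟨r, hr, _, ⟨v, hv, rfl⟩, rfl⟩
    exact ⟨r, hr, _, ⟨sphereMap ϑ v, hv, rfl⟩, (map_smul ϑ r (v : Rn n)).symm⟩
  · rintro ⟨r, hr, _, ⟨v, hv, rfl⟩, h⟩
    refine ⟨r, hr, _, ⟨sphereMap ϑ.symm v, ?_, rfl⟩, ?_⟩
    · rwa [show sphereMap ϑ (sphereMap ϑ.symm v) = v from Subtype.ext (ϑ.apply_symm_apply _)]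
    · have h' : r • (v : Rn n) = ϑ x := h
      rw [show ((sphereMap ϑ.symm v : Sph n) : Rn n) = ϑ.symm v from rfl, ← map_smul, h',
        ϑ.symm_apply_apply]

/-! ### The rotation group and its Haar measure -/

instance continuousStar_operators (n : ℕ) : ContinuousStar (Rn n →L[ℝ] Rn n) :=
  ⟨(ContinuousLinearMap.adjoint (𝕜 := ℝ) (E := Rn n) (F := Rn n)).continuous⟩

/-- The group `SO(n)`, topologized as a group of operators. -/
def rotationGroup (n : ℕ) : Subgroup (unitary (Rn n →L[ℝ] Rn n)) where
  carrier := {g | IsRotation (Unitary.linearIsometryEquiv g)}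
  mul_mem' {a b} ha hb := by
    simp only [mem_ofPred_eq, map_mul] at *
    exact hb.trans ha
  one_mem' := by
    simp only [mem_ofPred_eq, map_one]
    exact LinearMap.det_id
  inv_mem' {a} ha := by
    simp only [mem_ofPred_eq, map_inv] at *
    exact ha.symm

/-- The linear isometry given by an element of the rotation group. -/
def rotIso {n : ℕ} (g : rotationGroup n) : Rn n ≃ₗᵢ[ℝ] Rn n :=
  Unitary.linearIsometryEquiv (g : unitary (Rn n →L[ℝ] Rn n))

theorem isRotation_rotIso {n : ℕ} (g : rotationGroup n) : IsRotation (rotIso g) := g.2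

theorem exists_rotIso_eq {n : ℕ} {ϑ : Rn n ≃ₗᵢ[ℝ] Rn n} (h : IsRotation ϑ) :
    ∃ g : rotationGroup n, (rotIso g) = ϑ :=
  ⟨⟨Unitary.linearIsometryEquiv.symm ϑ, by
    change IsRotation _
    rwa [MulEquiv.apply_symm_apply]⟩, MulEquiv.apply_symm_apply _ _⟩

theorem rotIso_mul {n : ℕ} (g h : rotationGroup n) :
    rotIso (g * h) = (rotIso h).trans (rotIso g) := by
  simp only [rotIso, Subgroup.coe_mul, map_mul]
  rfl

/-- The defining equations are closed and isometries have operator norm at most one, so the group is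
a closed bounded subset of a finite-dimensional space. Compactness makes its Haar measure finite. -/
instance rotationGroup.compactSpace (n : ℕ) : CompactSpace (rotationGroup n) := by
  let f : rotationGroup n → (Rn n →L[ℝ] Rn n) := fun g => (g : unitary (Rn n →L[ℝ] Rn n))
  have hrange : range f = {T | star T * T = 1} ∩ {T | T * star T = 1} ∩ {T | T.det = 1} := by
    ext T
    constructor
    · rintro ⟨g, rfl⟩
      exact ⟨⟨(Unitary.mem_iff.1 g.1.2).1, (Unitary.mem_iff.1 g.1.2).2⟩, g.2⟩
    · rintro ⟨⟨h1, h2⟩, h3⟩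
      exact ⟨⟨⟨T, Unitary.mem_iff.2 ⟨h1, h2⟩⟩, h3⟩, rfl⟩
  have hclosed : IsClosed (range f) := by
    rw [hrange]
    have h1 : Continuous fun T : Rn n →L[ℝ] Rn n => star T * T :=
      Continuous.mul continuous_star continuous_id
    have h2 : Continuous fun T : Rn n →L[ℝ] Rn n => T * star T :=
      Continuous.mul continuous_id continuous_star
    refine (IsClosed.inter ?_ ?_).inter ?_
    · exact isClosed_eq h1 continuous_const
    · exact isClosed_eq h2 continuous_const
    · exact isClosed_eq ContinuousLinearMap.continuous_det continuous_const
  have hbdd : Bornology.IsBounded (range f) := by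
    refine (isBounded_closedBall (x := (0 : Rn n →L[ℝ] Rn n)) (r := 1)).subset ?_
    rintro _ ⟨g, rfl⟩
    rw [mem_closedBall, dist_zero_right]
    refine ContinuousLinearMap.opNorm_le_bound _ zero_le_one fun x => ?_
    rw [one_mul]
    exact (Unitary.norm_map g.1 x).le
  have : ProperSpace (Rn n →L[ℝ] Rn n) := FiniteDimensional.proper ℝ _
  have hc : IsCompact (range f) := isCompact_of_isClosed_isBounded hclosed hbdd
  have hind : Topology.IsInducing f :=
    Topology.IsInducing.subtypeVal.comp Topology.IsInducing.subtypeVal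
  rw [← isCompact_univ_iff, hind.isCompact_iff, image_univ]
  exact hc

instance rotationGroup.secondCountable (n : ℕ) : SecondCountableTopology (rotationGroup n) := by
  have : SecondCountableTopology (unitary (Rn n →L[ℝ] Rn n)) :=
    TopologicalSpace.Subtype.secondCountableTopology _
  exact TopologicalSpace.Subtype.secondCountableTopology _

theorem rotationGroup.continuous_action (n : ℕ) :
    Continuous fun q : rotationGroup n × Sph n => sphereMap (rotIso q.1) q.2 := by
  refine Continuous.subtype_mk ?_ _
  change Continuous fun q : rotationGroup n × Sph n =>
    ((q.1 : unitary (Rn n →L[ℝ] Rn n)) : Rn n →L[ℝ] Rn n) (q.2 : Rn n)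
  exact (continuous_subtype_val.comp (continuous_subtype_val.comp continuous_fst)).clm_apply
    (continuous_subtype_val.comp continuous_snd)

instance (n : ℕ) : IsTopologicalGroup (rotationGroup n) :=
  Subgroup.instIsTopologicalGroupSubtypeMem _

instance (n : ℕ) : BorelSpace (rotationGroup n) := Subtype.borelSpace _

instance (n : ℕ) : MeasurableMul (rotationGroup n) := ContinuousMul.measurableMul

instance (n : ℕ) : MeasurableInv (rotationGroup n) := ContinuousInv.measurableInv

/-- The right-invariant Haar measure of the rotation group. -/
def rotationHaar (n : ℕ) : Measure (rotationGroup n) := (Measure.haar : Measure (rotationGroup n)).inv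

instance (n : ℕ) : (rotationHaar n).IsMulRightInvariant := by
  unfold rotationHaar; infer_instance

instance (n : ℕ) : IsFiniteMeasure (rotationHaar n) :=
  ⟨by simp [rotationHaar, Measure.inv_apply, measure_lt_top]⟩

instance (n : ℕ) : (rotationHaar n).IsOpenPosMeasure :=
  ⟨fun U hU hne => by
    rw [rotationHaar, Measure.inv_apply]
    exact hU.inv.measure_ne_zero _ hne.inv⟩

/-- The average of a function over all rotations of a point does not depend on the point. -/
theorem integral_rotationHaar_eq {n : ℕ} (hn : 3 ≤ n) {f : Sph n → ℝ} (v w : Sph n) :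
    ∫ g : rotationGroup n, f (sphereMap (rotIso g) v) ∂rotationHaar n =
      ∫ g : rotationGroup n, f (sphereMap (rotIso g) w) ∂rotationHaar n := by
  obtain ⟨ϑ, hϑ, h⟩ := exists_rotation_map_eq hn w v
  obtain ⟨g₀, rfl⟩ := exists_rotIso_eq hϑ
  -- With `v = g₀ w`, the substitution `g ↦ g g₀` is where right invariance is needed.
  rw [← integral_mul_right_eq_self (fun g : rotationGroup n => f (sphereMap (rotIso g) w)) g₀]
  simp only [rotIso_mul, sphereMap_trans, h]

/-- Fubini on the product of sphere and group: the inner integral over the group does not depend on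
the point, and the one over the sphere does not depend on the rotation. -/
theorem integral_rotationHaar_mul {n : ℕ} (hn : 3 ≤ n) {f : Sph n → ℝ} (hf : Continuous f)
    (w : Sph n) :
    (volume : Measure (Rn n)).toSphere.real univ *
        ∫ g : rotationGroup n, f (sphereMap (rotIso g) w) ∂rotationHaar n =
      (rotationHaar n).real univ * ∫ u, f u ∂(volume : Measure (Rn n)).toSphere := by
  have hc : Continuous fun q : Sph n × rotationGroup n => f (sphereMap (rotIso q.2) q.1) :=
    hf.comp ((rotationGroup.continuous_action n).comp continuous_swap)
  have hswap := integral_integral_swap (μ := (volume : Measure (Rn n)).toSphere)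
    (ν := rotationHaar n) (f := fun v g => f (sphereMap (rotIso g) v))
    (integrable_of_continuous hc _)
  have h1 : ∀ v : Sph n, ∫ g : rotationGroup n, f (sphereMap (rotIso g) v) ∂rotationHaar n =
      ∫ g : rotationGroup n, f (sphereMap (rotIso g) w) ∂rotationHaar n :=
    fun v => integral_rotationHaar_eq hn v w
  have h2 : ∀ g : rotationGroup n, ∫ v, f (sphereMap (rotIso g) v) ∂(volume : Measure (Rn n)).toSphere
      = ∫ v, f v ∂(volume : Measure (Rn n)).toSphere := fun g => by
    nth_rewrite 2 [← toSphere_map_sphereMap (rotIso g)]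
    rw [integral_map (continuous_sphereMap _).aemeasurable hf.aestronglyMeasurable]
  simpa only [h1, h2, integral_const, smul_eq_mul] using hswap

/-! ### Zonal measures, their `L_p` zonoids, and the operator `Φ_p^μ` -/

theorem lpCosine_rotation {n : ℕ} {p : ℝ} (hp : 1 ≤ p) {e : Sph n} {μ : Measure (Sph n)}
    [IsFiniteMeasure μ] (hμ : IsZonalMeasure e μ) {ϑ : Rn n ≃ₗᵢ[ℝ] Rn n} (hϑ : IsRotation ϑ)
    (he : sphereMap ϑ e = e) (x : Rn n) : lpCosine p hp μ (ϑ x) = lpCosine p hp μ x := by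
  have hp0 : 0 ≤ p := by linarith
  rw [lpCosine_apply, lpCosine_apply]
  congr 1
  nth_rewrite 1 [← hμ ϑ hϑ he]
  rw [integral_map (continuous_sphereMap ϑ).aemeasurable]
  · refine integral_congr_ae (ae_of_all _ fun v => ?_)
    simp only [sphereMap, ϑ.inner_map_map]
  · refine Continuous.aestronglyMeasurable ?_
    exact Continuous.rpow_const (by fun_prop) fun _ => Or.inr hp0

/-- The support function of the `L_p` zonoid of a zonal measure is zonal. -/
theorem lpCosine_eq_of_zonal {n : ℕ} (hn : 3 ≤ n) {p : ℝ} (hp : 1 ≤ p) {e : Sph n}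
    {μ : Measure (Sph n)} [IsFiniteMeasure μ] (hμ : IsZonalMeasure e μ) {x y : Rn n}
    (hxy : ‖x‖ = ‖y‖) (hexy : ⟪x, e⟫ = ⟪y, e⟫) : lpCosine p hp μ x = lpCosine p hp μ y := by
  obtain ⟨ϑ, h, h1, h2⟩ := exists_rotation_map_pair hn hxy (y := (e : Rn n)) rfl hexy
  rw [← h1, lpCosine_rotation hp hμ h (Subtype.ext h2)]

/-- `lpZonoidAt` is a union over all rotations taking `e` to the given point. Two such rotations
pull `x` back to vectors of equal norm and equal inner product with `e`, where the zonal support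
function agrees; hence one rotation suffices. -/
theorem supportFn_lpZonoidAt {n : ℕ} (hn : 3 ≤ n) {p : ℝ} (hp : 1 ≤ p) {e : Sph n}
    {μ : Measure (Sph n)} [IsFiniteMeasure μ] (hμ : IsZonalMeasure e μ)
    {ϑ : Rn n ≃ₗᵢ[ℝ] Rn n} (hϑ : IsRotation ϑ) (x : Rn n) :
    supportFn (lpZonoidAt p e μ (sphereMap ϑ e)) x = lpCosine p hp μ (ϑ.symm x) := by
  have hZ : lpZonoid p μ = bodyOfSupport (fun u : Sph n => lpCosine p hp μ u) := rfl
  refine IsGreatest.csSup_eq ⟨?_, ?_⟩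
  · obtain ⟨y, hy, hys⟩ := exists_inner_eq_seminorm (lpCosine p hp μ) (ϑ.symm x)
    refine ⟨ϑ y, ⟨ϑ, hϑ, rfl, y, ?_, rfl⟩, ?_⟩
    · rw [hZ, mem_bodyOfSupport_iff]
      exact hys
    · simp only
      rw [← hy, ← ϑ.inner_map_map (ϑ.symm x), ϑ.apply_symm_apply]
  · rintro _ ⟨_, ⟨ρ, hρ, hρe, y, hy, rfl⟩, rfl⟩
    rw [hZ, mem_bodyOfSupport_iff] at hy
    have h1 : lpCosine p hp μ (ρ.symm x) = lpCosine p hp μ (ϑ.symm x) := by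
      refine lpCosine_eq_of_zonal hn hp hμ (by simp) ?_
      rw [← ρ.inner_map_map, ← ϑ.inner_map_map (ϑ.symm x), ρ.apply_symm_apply, ϑ.apply_symm_apply]
      exact congrArg (fun w : Sph n => ⟪x, (w : Rn n)⟫) hρe
    have h2 := hy (ρ.symm x)
    rw [← ρ.inner_map_map, ρ.apply_symm_apply, h1] at h2
    exact h2

/-- A rotation that maps the pole `e` to `v`. -/
def rotationTo {n : ℕ} (hn : 3 ≤ n) (e v : Sph n) : Rn n ≃ₗᵢ[ℝ] Rn n :=
  (exists_rotation_map_eq hn e v).choose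

theorem isRotation_rotationTo {n : ℕ} (hn : 3 ≤ n) (e v : Sph n) :
    IsRotation (rotationTo hn e v) := (exists_rotation_map_eq hn e v).choose_spec.1

theorem sphereMap_rotationTo {n : ℕ} (hn : 3 ≤ n) (e v : Sph n) :
    sphereMap (rotationTo hn e v) e = v := (exists_rotation_map_eq hn e v).choose_spec.2

/-- The support function of `Z_p^μ(v)`. -/
def zonoidSeminorm {n : ℕ} (hn : 3 ≤ n) (p : ℝ) (hp : 1 ≤ p) (e : Sph n) (μ : Measure (Sph n))
    [IsFiniteMeasure μ] (v : Sph n) : Seminorm ℝ (Rn n) :=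
  (lpCosine p hp μ).comp ((rotationTo hn e v).symm.toLinearEquiv : Rn n →ₗ[ℝ] Rn n)

/-- Exchanging the roles of the axis and of the argument in the support function of `Z_p^μ(v)`. -/
theorem zonoidSeminorm_eq {n : ℕ} (hn : 3 ≤ n) {p : ℝ} (hp : 1 ≤ p) {e : Sph n}
    {μ : Measure (Sph n)} [IsFiniteMeasure μ] (hμ : IsZonalMeasure e μ)
    (ϑ : Rn n ≃ₗᵢ[ℝ] Rn n) (v : Sph n) :
    zonoidSeminorm hn p hp e μ v (ϑ e) = lpCosine p hp μ (ϑ.symm v) := by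
  refine lpCosine_eq_of_zonal hn hp hμ (by simp) ?_
  change ⟪(rotationTo hn e v).symm (ϑ e), (e : Rn n)⟫ = _
  rw [← (rotationTo hn e v).inner_map_map, ← ϑ.inner_map_map (ϑ.symm _), ϑ.apply_symm_apply,
    LinearIsometryEquiv.apply_symm_apply, real_inner_comm]
  exact congrArg (fun w : Sph n => ⟪(w : Rn n), ϑ e⟫) (sphereMap_rotationTo hn e v)

/-- The chosen `rotationTo hn e v` need not be continuous in `v`; exchanging axis and argument moves
`v` into the argument of a fixed seminorm. -/
theorem continuous_zonoidSeminorm {n : ℕ} (hn : 3 ≤ n) {p : ℝ} (hp : 1 ≤ p) {e : Sph n}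
    {μ : Measure (Sph n)} [IsFiniteMeasure μ] (hμ : IsZonalMeasure e μ) (x : Rn n) :
    Continuous fun v => zonoidSeminorm hn p hp e μ v x := by
  rcases eq_or_ne x 0 with rfl | hx
  · simpa using continuous_const
  obtain ⟨u, hu⟩ := exists_eq_norm_smul hx
  have h : ∀ v, zonoidSeminorm hn p hp e μ v x =
      ‖x‖ * lpCosine p hp μ ((rotationTo hn e u).symm v) := fun v => by
    rw [← zonoidSeminorm_eq hn hp hμ, show rotationTo hn e u e = (u : Rn n) from
      congrArg Subtype.val (sphereMap_rotationTo hn e u),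
      ← seminorm_smul_of_nonneg _ (norm_nonneg x), ← hu]
  simp only [h]
  exact continuous_const.mul ((continuous_seminorm _).comp
    ((rotationTo hn e u).symm.continuous.comp continuous_subtype_val))

/-- The support function of `Φ_p^μ K`, in terms of `ν = S_p(K, ·)`. -/
def phiSeminorm {n : ℕ} (hn : 3 ≤ n) (p : ℝ) (hp : 1 ≤ p) (e : Sph n) (μ ν : Measure (Sph n))
    [IsFiniteMeasure μ] [IsFiniteMeasure ν] (hμ : IsZonalMeasure e μ) : Seminorm ℝ (Rn n) :=
  lpMean p hp ν (zonoidSeminorm hn p hp e μ)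
    (fun x => memLp_of_continuous (continuous_zonoidSeminorm hn hp hμ x) ν _)

theorem phiBody_eq {n : ℕ} (hn : 3 ≤ n) {p : ℝ} (hp : 1 ≤ p) {e : Sph n} {μ : Measure (Sph n)}
    [IsFiniteMeasure μ] (hμ : IsZonalMeasure e μ) (K : Set (Rn n))
    [IsFiniteMeasure (lpSurfaceAreaMeasure p K)] :
    phiBody p e μ K = bodyOfSupport fun u : Sph n =>
      phiSeminorm hn p hp e μ (lpSurfaceAreaMeasure p K) hμ u := by
  unfold phiBody
  congr 1
  ext u
  rw [phiSeminorm, lpMean_apply]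
  congr 1
  refine integral_congr_ae (ae_of_all _ fun v => ?_)
  have h1 := supportFn_lpZonoidAt hn hp hμ (isRotation_rotationTo hn e u) v
  rw [sphereMap_rotationTo] at h1
  simp only
  rw [h1, ← zonoidSeminorm_eq hn hp hμ]
  rw [show rotationTo hn e u e = (u : Rn n) from congrArg Subtype.val (sphereMap_rotationTo hn e u)]

theorem lpProjectionBody_eq {n : ℕ} {p : ℝ} (hp : 1 ≤ p) (K : Set (Rn n))
    [IsFiniteMeasure (lpSurfaceAreaMeasure p K)] (ha : 0 ≤ aConst n p) :
    lpProjectionBody p K = bodyOfSupport fun u : Sph n =>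
      lpCosine p hp ((aConst n p).toNNReal • lpSurfaceAreaMeasure p K) u := by
  unfold lpProjectionBody
  congr 1
  ext u
  rw [lpCosine_apply, integral_smul_nnreal_measure, NNReal.smul_def, smul_eq_mul,
    Real.coe_toNNReal _ ha]

/-- The identity behind the averaging: after axis and argument are exchanged, both sides are the
double integral of `|v · ϑ w|^p` against `μ` and `ν`, by Fubini. -/
theorem phiSeminorm_rpow {n : ℕ} (hn : 3 ≤ n) {p : ℝ} (hp : 1 ≤ p) {e : Sph n}
    {μ ν : Measure (Sph n)} [IsFiniteMeasure μ] [IsFiniteMeasure ν] (hμ : IsZonalMeasure e μ)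
    (ϑ : Rn n ≃ₗᵢ[ℝ] Rn n) :
    phiSeminorm hn p hp e μ ν hμ (ϑ e) ^ p = ∫ w : Sph n, lpCosine p hp ν (ϑ w) ^ p ∂μ := by
  have hp0 : 0 ≤ p := by linarith
  rw [phiSeminorm, lpMean_apply, ← Real.rpow_mul (integral_nonneg fun v => by positivity),
    one_div_mul_cancel (by linarith), Real.rpow_one]
  simp only [zonoidSeminorm_eq hn hp hμ, lpCosine_rpow]
  have hc : Continuous fun q : Sph n × Sph n => |⟪ϑ.symm q.1, (q.2 : Rn n)⟫| ^ p := by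
    refine Continuous.rpow_const ?_ fun _ => Or.inr hp0
    have : Continuous fun q : Sph n × Sph n => ϑ.symm q.1 := ϑ.symm.continuous.comp (by fun_prop)
    fun_prop
  rw [integral_integral_swap (f := fun v w : Sph n => |⟪ϑ.symm v, (w : Rn n)⟫| ^ p)
    (integrable_of_continuous hc _)]
  refine integral_congr_ae (ae_of_all _ fun w => integral_congr_ae (ae_of_all _ fun v => ?_))
  simp only
  rw [← ϑ.inner_map_map, ϑ.apply_symm_apply, real_inner_comm]

/-! ### Discrete zonal measures -/

/-- The latitude through a point other than the poles is infinite. -/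
theorem infinite_latitude {n : ℕ} (hn : 3 ≤ n) {e w : Sph n} (h1 : w ≠ e) (h2 : w ≠ -e) :
    {v : Sph n | ⟪(v : Rn n), (e : Rn n)⟫ = ⟪(w : Rn n), (e : Rn n)⟫}.Infinite := by
  set c : ℝ := ⟪(w : Rn n), (e : Rn n)⟫ with hc
  have hee : ⟪(e : Rn n), (e : Rn n)⟫ = 1 := by simp
  let z : Rn n := w - c • (e : Rn n)
  have hze : ⟪(e : Rn n), z⟫ = 0 := by
    simp only [z, inner_sub_right, real_inner_smul_right, hee, real_inner_comm, hc, mul_one]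
    rw [real_inner_comm]; ring
  have hz0 : z ≠ 0 := by
    intro h
    have hw : (w : Rn n) = c • (e : Rn n) := sub_eq_zero.1 h
    have hn1 := congrArg norm hw
    rw [norm_smul, norm_eq_of_mem_sphere, norm_eq_of_mem_sphere, mul_one, Real.norm_eq_abs] at hn1
    rcases (abs_eq zero_le_one).1 hn1.symm with hc1 | hc1
    · exact h1 (Subtype.ext (by rw [hw, hc1, one_smul]))
    · exact h2 (Subtype.ext (by rw [hw, hc1]; simp))
  let E : Submodule ℝ (Rn n) := (ℝ ∙ (e : Rn n))ᗮ
  have hrank : 1 < Module.rank ℝ E := by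
    have he0 : (e : Rn n) ≠ 0 := ne_zero_of_mem_unit_sphere e
    have h := Submodule.finrank_add_finrank_orthogonal (ℝ ∙ (e : Rn n))
    rw [finrank_span_singleton he0, finrank_euclideanSpace, Fintype.card_fin] at h
    rw [← Module.finrank_eq_rank, Nat.one_lt_cast]
    change 1 < Module.finrank ℝ (ℝ ∙ (e : Rn n))ᗮ
    omega
  have hzE : z ∈ E := Submodule.mem_orthogonal_singleton_iff_inner_right.2 hze
  -- Since `e^⊥` has dimension at least two, this sphere is connected, and it contains the distinct
  -- points `z` and `-z`. Translating it by `c e` embeds it in the latitude.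
  have hinf : (sphere (0 : E) ‖z‖).Infinite := by
    refine (isPreconnected_sphere hrank 0 ‖z‖).infinite_of_nontrivial
      ⟨⟨z, hzE⟩, by simp, -⟨z, hzE⟩, by simp, ?_⟩
    intro h
    have h' : z = -z := congrArg Subtype.val h
    have h'' : (2 : ℝ) • z = 0 := by rw [two_smul]; nth_rewrite 1 [h']; exact neg_add_cancel z
    exact hz0 ((smul_eq_zero.1 h'').resolve_left two_ne_zero)
  have hnorm : ∀ y : E, ‖y‖ = ‖z‖ → ‖(y : Rn n) + c • (e : Rn n)‖ = 1 := by
    intro y hy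
    have hye : ⟪(y : Rn n), c • (e : Rn n)⟫ = 0 := by
      rw [real_inner_smul_right, Submodule.mem_orthogonal_singleton_iff_inner_left.1 y.2, mul_zero]
    have hze' : ⟪z, c • (e : Rn n)⟫ = 0 := by
      rw [real_inner_smul_right, real_inner_comm, hze, mul_zero]
    have e1 := norm_add_sq_eq_norm_sq_add_norm_sq_real hye
    have e2 := norm_add_sq_eq_norm_sq_add_norm_sq_real hze'
    have hw : z + c • (e : Rn n) = w := by simp [z]
    rw [hw, norm_eq_of_mem_sphere] at e2
    have hy' : ‖(y : Rn n)‖ = ‖z‖ := hy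
    rw [hy', ← e2, one_mul] at e1
    nlinarith [norm_nonneg ((y : Rn n) + c • (e : Rn n))]
  let f : sphere (0 : E) ‖z‖ → Sph n := fun y =>
    ⟨(y : E) + c • (e : Rn n), by
      rw [mem_sphere_zero_iff_norm]
      exact hnorm y (by simp)⟩
  have hf : Function.Injective f := by
    intro a b hab
    have := congrArg Subtype.val hab
    exact Subtype.ext (Subtype.ext (add_right_cancel this))
  have := hinf.to_subtype
  refine (infinite_range_of_injective hf).mono ?_
  rintro _ ⟨y, rfl⟩
  change ⟪((y : E) : Rn n) + c • (e : Rn n), (e : Rn n)⟫ = c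
  rw [inner_add_left, Submodule.mem_orthogonal_singleton_iff_inner_left.1 (y : E).2,
    real_inner_smul_left, hee, mul_one, zero_add]

theorem measure_singleton_eq_of_zonal {n : ℕ} (hn : 3 ≤ n) {e : Sph n} {μ : Measure (Sph n)}
    (hμ : IsZonalMeasure e μ) {v w : Sph n}
    (h : ⟪(v : Rn n), (e : Rn n)⟫ = ⟪(w : Rn n), (e : Rn n)⟫) : μ {v} = μ {w} := by
  obtain ⟨ϑ, hϑ, h1, h2⟩ := exists_rotation_map_pair hn (x := (v : Rn n)) (x' := w)
    (y := (e : Rn n)) (y' := e) (by simp) rfl h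
  conv_rhs => rw [← hμ ϑ hϑ (Subtype.ext h2), Measure.map_apply
    (continuous_sphereMap ϑ).measurable (measurableSet_singleton _)]
  congr 1
  ext x
  simp only [mem_singleton_iff, mem_preimage]
  constructor
  · rintro rfl
    exact Subtype.ext h1
  · intro hx
    have : sphereMap ϑ v = w := Subtype.ext h1
    rw [← sphereMap_symm_apply ϑ x, hx, ← this, sphereMap_symm_apply]

/-- A finite zonal measure is discrete if and only if it is concentrated on the two poles. -/
theorem isDiscreteMeasure_iff_of_zonal {n : ℕ} (hn : 3 ≤ n) {e : Sph n} {μ : Measure (Sph n)}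
    [IsFiniteMeasure μ] (hμ : IsZonalMeasure e μ) :
    IsDiscreteMeasure μ ↔ μ {e, -e}ᶜ = 0 := by
  refine ⟨?_, fun h => ⟨{e, -e}, by simp, h⟩⟩
  rintro ⟨s, hs, hμs⟩
  have h1 : ∀ w ∈ s \ {e, -e}, μ {w} = 0 := by
    rintro w ⟨-, hw⟩
    simp only [mem_insert_iff, mem_singleton_iff, not_or] at hw
    by_contra h0
    -- Every point of the latitude through `w` has the same mass as `w`; a finite measure admits
    -- only finitely many such atoms.
    refine (Measure.finite_const_le_meas_of_disjoint_iUnion μ (pos_iff_ne_zero.2 h0)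
      (As := fun v : Sph n => {v}) (fun v => measurableSet_singleton v)
      (fun a b hab => by simpa using hab) (measure_ne_top _ _)).not_infinite ?_
    refine (infinite_latitude hn hw.1 hw.2).mono fun v hv => ?_
    exact (measure_singleton_eq_of_zonal hn hμ hv).ge
  have h2 : μ (s \ {e, -e}) = 0 := by
    rw [← biUnion_of_singleton (s \ {e, -e}), measure_biUnion_null_iff (hs.mono sdiff_subset)]
    exact h1
  refine measure_mono_null (t := sᶜ ∪ s \ {e, -e}) (fun x hx => ?_) (measure_union_null hμs h2)
  by_cases hxs : x ∈ s
  · exact Or.inr ⟨hxs, hx⟩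
  · exact Or.inl hxs

/-! ### Jensen's inequality for negative powers -/

theorem strictConvexOn_rpow_of_neg {q : ℝ} (hq : q < 0) :
    StrictConvexOn ℝ (Ioi 0) fun x : ℝ => x ^ q := by
  refine strictConvexOn_of_deriv2_pos (convex_Ioi 0)
    (fun x hx => (Real.continuousAt_rpow_const x q (Or.inl (ne_of_gt hx))).continuousWithinAt) ?_
  intro x hx
  rw [interior_Ioi] at hx
  have hx : 0 < x := hx
  rw [Function.iterate_succ_apply, Function.iterate_one]
  have h1 : deriv (fun x : ℝ => x ^ q) =ᶠ[nhds x] fun x => q * x ^ (q - 1) := by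
    filter_upwards [isOpen_Ioi.mem_nhds hx] with y hy
    exact (Real.hasDerivAt_rpow_const (Or.inl (ne_of_gt hy))).deriv
  rw [h1.deriv_eq, deriv_const_mul _ (Real.differentiableAt_rpow_const_of_ne _ hx.ne'),
    (Real.hasDerivAt_rpow_const (Or.inl hx.ne')).deriv]
  have := Real.rpow_pos_of_pos hx (q - 1 - 1)
  nlinarith [mul_pos_of_neg_of_neg hq (by linarith : q - 1 < 0)]

/-- Jensen's inequality between the `L_p` mean and the `L_{-n}` mean of a positive function. -/
theorem jensen_inv_pow {X : Type*} [TopologicalSpace X] [CompactSpace X] [Nonempty X]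
    [MeasurableSpace X] [BorelSpace X] (μ : Measure X) [IsFiniteMeasure μ]
    {n : ℕ} (hn : 0 < n) {p : ℝ} (hp : 0 < p) {f : X → ℝ} (hf : Continuous f) (hf0 : ∀ x, 0 < f x)
    {b : ℝ} (hb : 0 < b) (hbp : b ^ p = ⨍ x, f x ^ p ∂μ) :
    (∀ᵐ x ∂μ, f x = b) ∨ b⁻¹ ^ n < ⨍ x, (f x)⁻¹ ^ n ∂μ := by
  have hpow : ∀ t : ℝ, 0 < t → (t ^ p) ^ (-((n : ℝ) / p)) = t⁻¹ ^ n := fun t ht => by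
    rw [← Real.rpow_mul ht.le, mul_neg, mul_div_cancel₀ _ hp.ne', Real.rpow_neg ht.le,
      Real.rpow_natCast, inv_pow]
  obtain ⟨x₀, -, hx₀⟩ := isCompact_univ.exists_isMinOn univ_nonempty hf.continuousOn
  have hm : ∀ x, f x₀ ≤ f x := fun x => hx₀ (mem_univ x)
  have hmp : 0 < f x₀ ^ p := Real.rpow_pos_of_pos (hf0 x₀) p
  have hfp : Continuous fun x => f x ^ p := hf.rpow_const fun x => Or.inl (hf0 x).ne'
  have hfn : Continuous fun x => (f x)⁻¹ ^ n := (hf.inv₀ fun x => (hf0 x).ne').pow n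
  have hq : -((n : ℝ) / p) < 0 := neg_neg_of_pos (div_pos (Nat.cast_pos.2 hn) hp)
  -- Jensen's inequality is applied on a closed convex set; the positive minimum of `f` provides a
  -- closed half-line inside the domain of convexity.
  have hsub : Ici (f x₀ ^ p) ⊆ Ioi 0 := fun t ht => lt_of_lt_of_le hmp ht
  have hconv := (strictConvexOn_rpow_of_neg hq).subset hsub (convex_Ici _)
  have hcomp : ((fun t : ℝ => t ^ (-((n : ℝ) / p))) ∘ fun x => f x ^ p) = fun x => (f x)⁻¹ ^ n :=
    funext fun x => hpow _ (hf0 x)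
  have key := hconv.ae_eq_const_or_map_average_lt (μ := μ) (f := fun x => f x ^ p)
    (fun t ht => (Real.continuousAt_rpow_const t _ (Or.inl (hsub ht).ne')).continuousWithinAt)
    isClosed_Ici (ae_of_all _ fun x => Real.rpow_le_rpow (hf0 x₀).le (hm x) hp.le)
    (integrable_of_continuous hfp μ) (hcomp ▸ integrable_of_continuous hfn μ)
  rw [← hbp, hpow b hb] at key
  refine key.imp (fun h => ?_) (fun h => ?_)
  · filter_upwards [h] with x hx
    exact (Real.rpow_left_inj (hf0 x).le hb.le hp.ne').1 hx
  · refine h.trans_eq ?_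
    simp only [hpow _ (hf0 _)]

/-! ### Comparison of the polar volumes -/

/-- If `F` takes the same value at all points at a fixed angle `arccos c ∉ {0, π}` from a given
point, then `F` is constant. -/
theorem eq_of_forall_inner_eq {n : ℕ} (hn : 3 ≤ n) {F H : Sph n → ℝ} {c : ℝ} (hc : c ^ 2 < 1)
    (h : ∀ u x : Sph n, ⟪(u : Rn n), (x : Rn n)⟫ = c → F u = H x) (u v : Sph n) : F u = F v := by
  have key : ∀ u v : Sph n, 2 * c ^ 2 - 1 < ⟪(u : Rn n), (v : Rn n)⟫ → F v = F u := by
    intro u v huv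
    obtain ⟨z, hz, huz, hvz⟩ := exists_ne_zero_inner_eq_zero hn (u : Rn n) v
    set s : ℝ := ⟪(u : Rn n), (v : Rn n)⟫ with hs
    have hs1 : 0 < 1 + s := by nlinarith [sq_nonneg c]
    have huu : ⟪(u : Rn n), (u : Rn n)⟫ = 1 := by simp
    have hvv : ⟪(v : Rn n), (v : Rn n)⟫ = 1 := by simp
    have hvu : ⟪(v : Rn n), (u : Rn n)⟫ = s := by rw [real_inner_comm]
    have hzz : ⟪z, z⟫ = ‖z‖ ^ 2 := real_inner_self_eq_norm_sq z
    have hz0 : 0 < ‖z‖ := norm_pos_iff.2 hz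
    have hτ : 0 ≤ 1 - 2 * c ^ 2 / (1 + s) := by
      rw [sub_nonneg, div_le_one hs1]; linarith
    -- A unit vector with inner product `c` against both `u` and `v`: its part in their span has
    -- squared norm `2c² / (1 + s)`, at most one by the choice of neighbourhood, and the orthogonal
    -- direction `z` supplies the rest.
    let x : Rn n := (c / (1 + s)) • ((u : Rn n) + v) + (√(1 - 2 * c ^ 2 / (1 + s)) / ‖z‖) • z
    have hux : ⟪(u : Rn n), x⟫ = c := by
      simp only [x, inner_add_right, real_inner_smul_right, huu, huz, ← hs]
      field_simp
      ring
    have hvx : ⟪(v : Rn n), x⟫ = c := by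
      simp only [x, inner_add_right, real_inner_smul_right, hvv, hvz, hvu]
      field_simp
      ring
    have hzx : ⟪z, x⟫ = √(1 - 2 * c ^ 2 / (1 + s)) * ‖z‖ := by
      have hzu : ⟪z, (u : Rn n)⟫ = 0 := by rw [real_inner_comm, huz]
      have hzv : ⟪z, (v : Rn n)⟫ = 0 := by rw [real_inner_comm, hvz]
      simp only [x, inner_add_right, real_inner_smul_right, hzu, hzv, hzz]
      field_simp
      ring
    have hxx : ⟪x, x⟫ = 1 := by
      nth_rewrite 1 [show x = (c / (1 + s)) • ((u : Rn n) + v) +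
        (√(1 - 2 * c ^ 2 / (1 + s)) / ‖z‖) • z from rfl]
      rw [inner_add_left, real_inner_smul_left, inner_add_left, real_inner_smul_left, hux, hvx,
        hzx, show √(1 - 2 * c ^ 2 / (1 + s)) / ‖z‖ * (√(1 - 2 * c ^ 2 / (1 + s)) * ‖z‖) =
          √(1 - 2 * c ^ 2 / (1 + s)) ^ 2 by field_simp, Real.sq_sqrt hτ]
      field_simp
      ring
    have hx1 : ‖x‖ = 1 := by
      rw [real_inner_self_eq_norm_sq] at hxx
      nlinarith [norm_nonneg x]
    rw [h v ⟨x, by simpa using hx1⟩ hvx, h u ⟨x, by simpa using hx1⟩ hux]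
  have hloc : IsLocallyConstant F := by
    refine (IsLocallyConstant.iff_eventually_eq F).2 fun u => ?_
    have hopen : IsOpen {v : Sph n | 2 * c ^ 2 - 1 < ⟪(u : Rn n), (v : Rn n)⟫} :=
      isOpen_lt continuous_const (by fun_prop)
    refine Filter.eventually_of_mem (hopen.mem_nhds ?_) fun v hv => key u v hv
    simp only [mem_ofPred_eq, real_inner_self_eq_norm_sq, norm_eq_of_mem_sphere]
    linarith
  have hrank : 1 < Module.rank ℝ (Rn n) := by
    rw [← Module.finrank_eq_rank, Nat.one_lt_cast, finrank_euclideanSpace, Fintype.card_fin]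
    omega
  have : PreconnectedSpace (Sph n) :=
    isPreconnected_iff_preconnectedSpace.1 (isPreconnected_sphere hrank (0 : Rn n) 1)
  exact hloc.apply_eq_of_isPreconnected isPreconnected_univ (mem_univ u) (mem_univ v)

section Comparison

variable {n : ℕ} (hn : 3 ≤ n) {p : ℝ} (hp : 1 ≤ p) {e : Sph n} {μ : Measure (Sph n)}
  [IsFiniteMeasure μ] [NeZero μ] {F H : Seminorm ℝ (Rn n)} (hF : ∀ u : Sph n, 0 < F u)
  (hFH : ∀ ϑ : Rn n ≃ₗᵢ[ℝ] Rn n, IsRotation ϑ → H (ϑ e) ^ p = ⨍ w : Sph n, F (ϑ w) ^ p ∂μ)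

include hn hp hF hFH

theorem pos_of_rpow_eq_average (u : Sph n) : 0 < H u := by
  obtain ⟨ϑ, hϑ, hu⟩ := exists_rotation_map_eq hn e u
  have h1 := hFH ϑ hϑ
  rw [show ϑ e = (u : Rn n) from congrArg Subtype.val hu] at h1
  have hcont : Continuous fun w : Sph n => F (ϑ w) ^ p :=
    ((continuous_seminorm F).comp (ϑ.continuous.comp continuous_subtype_val)).rpow_const
      fun w => Or.inr (by linarith)
  have h2 : 0 < ⨍ w : Sph n, F (ϑ w) ^ p ∂μ := by
    rw [average_eq]
    refine smul_pos (inv_pos.2 (by simp [measureReal_def, ENNReal.toReal_pos_iff, NeZero.pos])) ?_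
    rw [integral_pos_iff_support_of_nonneg (fun w => Real.rpow_nonneg (apply_nonneg F _) _)
      (integrable_of_continuous hcont μ)]
    rw [show Function.support (fun w : Sph n => F (ϑ w) ^ p) = univ from
      eq_univ_of_forall fun w => (Real.rpow_pos_of_pos (hF (sphereMap ϑ w)) p).ne']
    exact NeZero.pos _
  rw [← h1] at h2
  refine lt_of_le_of_ne (apply_nonneg H _) fun h0 => ?_
  rw [← h0, Real.zero_rpow (by linarith)] at h2
  exact lt_irrefl _ h2

omit hn hp [IsFiniteMeasure μ] [NeZero μ] hF hFH in
theorem continuous_inv_pow_action {G : Seminorm ℝ (Rn n)} (hG : ∀ u : Sph n, 0 < G u) :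
    Continuous fun q : rotationGroup n × Sph n => (G (sphereMap (rotIso q.1) q.2))⁻¹ ^ n :=
  (((continuous_seminorm G).comp (continuous_subtype_val.comp
    (rotationGroup.continuous_action n))).inv₀ fun _ => (hG _).ne').pow n

/-- Comparison of the averages of `H^{-n}` and `F^{-n}` over the rotation group, with a
characterization of the equality case. -/
theorem integral_rotationHaar_inv_pow_le :
    (∫ g : rotationGroup n, (H (sphereMap (rotIso g) e))⁻¹ ^ n ∂rotationHaar n ≤
      ∫ g : rotationGroup n, (F (sphereMap (rotIso g) e))⁻¹ ^ n ∂rotationHaar n) ∧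
    (∫ g : rotationGroup n, (H (sphereMap (rotIso g) e))⁻¹ ^ n ∂rotationHaar n =
      ∫ g : rotationGroup n, (F (sphereMap (rotIso g) e))⁻¹ ^ n ∂rotationHaar n →
      ∀ g : rotationGroup n, ∀ᵐ w ∂μ, F (sphereMap (rotIso g) w) = H (sphereMap (rotIso g) e)) := by
  have hH := pos_of_rpow_eq_average hn hp hF hFH
  have hF2 := continuous_inv_pow_action hF
  have hH2 := continuous_inv_pow_action hH
  have hμ0 : 0 < μ.real univ := by simp [measureReal_def, ENNReal.toReal_pos_iff, NeZero.pos]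
  have : Nonempty (Sph n) := ⟨e⟩
  let A : rotationGroup n → ℝ := fun g => (H (sphereMap (rotIso g) e))⁻¹ ^ n
  let B : rotationGroup n → ℝ := fun g => ⨍ w, (F (sphereMap (rotIso g) w))⁻¹ ^ n ∂μ
  have hA : Continuous A := hH2.comp (continuous_id.prodMk continuous_const)
  have hB : Continuous B := by
    have h := continuous_parametric_integral_of_continuous (μ := μ)
      (f := fun (g : rotationGroup n) (w : Sph n) => (F (sphereMap (rotIso g) w))⁻¹ ^ n) hF2
      isCompact_univ
    simp only [Measure.restrict_univ] at h
    simp only [B, average_eq, smul_eq_mul]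
    exact continuous_const.mul h
  have hjen : ∀ g, (∀ᵐ w ∂μ, F (sphereMap (rotIso g) w) = H (sphereMap (rotIso g) e)) ∨
      A g < B g := fun g =>
    jensen_inv_pow μ (by omega) (by linarith : 0 < p)
      ((continuous_seminorm F).comp (continuous_subtype_val.comp (continuous_sphereMap (rotIso g))))
      (fun w => hF _) (hH _) (hFH _ (isRotation_rotIso g))
  have hle : ∀ g, A g ≤ B g := fun g => by
    rcases hjen g with h | h
    · have : B g = ⨍ _ : Sph n, (H (sphereMap (rotIso g) e))⁻¹ ^ n ∂μ :=
        average_congr (by filter_upwards [h] with w hw; rw [hw])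
      rw [this, average_const]
    · exact h.le
  have hBint : ∫ g, B g ∂rotationHaar n =
      ∫ g : rotationGroup n, (F (sphereMap (rotIso g) e))⁻¹ ^ n ∂rotationHaar n := by
    simp only [B, average_eq]
    rw [integral_smul, integral_integral_swap
      (f := fun (g : rotationGroup n) (w : Sph n) => (F (sphereMap (rotIso g) w))⁻¹ ^ n)
      (integrable_of_continuous hF2 _)]
    have hconst : ∀ w : Sph n,
        ∫ g : rotationGroup n, (F (sphereMap (rotIso g) w))⁻¹ ^ n ∂rotationHaar n =
          ∫ g : rotationGroup n, (F (sphereMap (rotIso g) e))⁻¹ ^ n ∂rotationHaar n :=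
      fun w => integral_rotationHaar_eq hn (f := fun u : Sph n => (F u)⁻¹ ^ n) w e
    simp only [hconst, integral_const, smul_eq_mul]
    rw [inv_mul_cancel_left₀ hμ0.ne']
  have hAi := integrable_of_continuous hA (rotationHaar n)
  have hBi := integrable_of_continuous hB (rotationHaar n)
  refine ⟨hBint ▸ integral_mono hAi hBi hle, fun heq g => ?_⟩
  -- Equal integrals give equality almost everywhere; continuity and positivity of Haar measure on
  -- open sets give it at every rotation.
  have hAB : A = B := by
    refine (hA.ae_eq_iff_eq (rotationHaar n) hB).1 ?_
    refine ((integral_eq_iff_of_ae_le hAi hBi (ae_of_all _ hle)).1 ?_)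
    rw [hBint]
    exact heq
  exact (hjen g).resolve_right (by rw [hAB]; exact lt_irrefl _)

theorem integral_toSphere_inv_pow_le :
    (∫ u : Sph n, (H u)⁻¹ ^ n ∂(volume : Measure (Rn n)).toSphere ≤
      ∫ u : Sph n, (F u)⁻¹ ^ n ∂(volume : Measure (Rn n)).toSphere) ∧
    (∫ u : Sph n, (H u)⁻¹ ^ n ∂(volume : Measure (Rn n)).toSphere =
      ∫ u : Sph n, (F u)⁻¹ ^ n ∂(volume : Measure (Rn n)).toSphere →
      ∀ g : rotationGroup n, ∀ᵐ w ∂μ, F (sphereMap (rotIso g) w) = H (sphereMap (rotIso g) e)) := by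
  obtain ⟨h1, h2⟩ := integral_rotationHaar_inv_pow_le hn hp hF hFH
  have hH := pos_of_rpow_eq_average hn hp hF hFH
  have hc : ∀ {G : Seminorm ℝ (Rn n)}, (∀ u : Sph n, 0 < G u) →
      Continuous fun u : Sph n => (G u)⁻¹ ^ n := fun {G} hG =>
    (((continuous_seminorm G).comp continuous_subtype_val).inv₀ fun _ => (hG _).ne').pow n
  have eF := integral_rotationHaar_mul hn (hc hF) e
  have eH := integral_rotationHaar_mul hn (hc hH) e
  have hm : 0 < (rotationHaar n).real univ :=
    ENNReal.toReal_pos (isOpen_univ.measure_ne_zero _ univ_nonempty) (measure_ne_top _ _)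
  have hσ : 0 < ((volume : Measure (Rn n)).toSphere).real univ :=
    ENNReal.toReal_pos (isOpen_univ.measure_ne_zero _ ⟨e, mem_univ e⟩) (measure_ne_top _ _)
  constructor
  · refine le_of_mul_le_mul_left ?_ hm
    rw [← eF, ← eH]
    exact mul_le_mul_of_nonneg_left h1 hσ.le
  · intro heq
    refine h2 (mul_left_cancel₀ hσ.ne' ?_)
    rw [eF, eH, heq]

theorem volume_le_and_eq_iff (hμ : IsZonalMeasure e μ) :
    volume {x | H x ≤ 1} ≤ volume {x | F x ≤ 1} ∧
      (volume {x | H x ≤ 1} = volume {x | F x ≤ 1} ↔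
        (IsDiscreteMeasure μ ∨ ∃ r, ∀ u : Sph n, F u = r)) := by
  have hH := pos_of_rpow_eq_average hn hp hF hFH
  obtain ⟨h1, h2⟩ := integral_toSphere_inv_pow_le hn hp hF hFH
  have hn0 : (0 : ℝ) < n := by positivity
  rw [volume_seminorm_le_one (by omega) F hF, volume_seminorm_le_one (by omega) H hH]
  have hnn : ∀ {G : Seminorm ℝ (Rn n)}, (∀ u : Sph n, 0 < G u) →
      0 ≤ ∫ u : Sph n, (G u)⁻¹ ^ n ∂(volume : Measure (Rn n)).toSphere := fun {G} hG =>
    integral_nonneg fun u => by have := hG u; positivity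
  refine ⟨ENNReal.ofReal_le_ofReal (by gcongr), ?_⟩
  rw [ENNReal.ofReal_eq_ofReal_iff (div_nonneg (hnn hH) hn0.le) (div_nonneg (hnn hF) hn0.le),
    div_left_inj' hn0.ne']
  constructor
  · intro heq
    by_contra! hcon
    obtain ⟨hd, hc⟩ := hcon
    have hpt := h2 heq
    rw [isDiscreteMeasure_iff_of_zonal hn hμ] at hd
    -- At a point of the support, an almost-everywhere identity between continuous functions holds
    -- exactly, for every rotation at once.
    obtain ⟨w, hw, hws⟩ := Measure.nonempty_inter_support_of_pos (pos_iff_ne_zero.2 hd)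
    simp only [mem_compl_iff, mem_insert_iff, mem_singleton_iff, not_or] at hw
    have hval : ∀ g : rotationGroup n, F (sphereMap (rotIso g) w) = H (sphereMap (rotIso g) e) := by
      intro g
      by_contra hne
      have hopen : IsOpen {v : Sph n | F (sphereMap (rotIso g) v) ≠ H (sphereMap (rotIso g) e)} :=
        isOpen_ne_fun ((continuous_seminorm F).comp (continuous_subtype_val.comp
          (continuous_sphereMap (rotIso g)))) continuous_const
      exact ((Measure.mem_support_iff_forall w).1 hws _ (hopen.mem_nhds hne)).ne' (hpt g)
    have hc1 : ⟪(w : Rn n), (e : Rn n)⟫ ^ 2 < 1 := by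
      have hlt : |⟪(w : Rn n), (e : Rn n)⟫| < 1 := by
        rw [abs_lt]
        constructor
        · rw [← neg_lt, ← inner_neg_right]
          refine inner_lt_one_iff_real_of_norm_eq_one (by simp) (by simp) |>.2 fun h => hw.2 ?_
          exact Subtype.ext h
        · exact inner_lt_one_iff_real_of_norm_eq_one (by simp) (by simp) |>.2 fun h =>
            hw.1 (Subtype.ext h)
      exact (sq_lt_one_iff_abs_lt_one _).2 hlt
    have hconst := eq_of_forall_inner_eq hn (F := fun u => F u) (H := fun u => H u) hc1
      (fun u x hux => by
        obtain ⟨ϑ, hϑ, e1, e2⟩ := exists_rotation_map_pair hn (x := (w : Rn n)) (x' := u)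
          (y := (e : Rn n)) (y' := x) (by simp) (by simp) hux.symm
        obtain ⟨g, rfl⟩ := exists_rotIso_eq hϑ
        have h := hval g
        rwa [show sphereMap (rotIso g) w = u from Subtype.ext e1,
          show sphereMap (rotIso g) e = x from Subtype.ext e2] at h)
    obtain ⟨v, hv⟩ := hc (F e)
    exact hv (hconst v e)
  · intro hcase
    suffices h : ∀ u : Sph n, H u = F u by simp only [h]
    intro u
    obtain ⟨ϑ, hϑ, hu⟩ := exists_rotation_map_eq hn e u
    have hue : ϑ e = (u : Rn n) := congrArg Subtype.val hu
    have hav := hFH ϑ hϑ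
    have hae : ∀ᵐ w : Sph n ∂μ, F (ϑ w) ^ p = F u ^ p := by
      rcases hcase with hd | ⟨r, hr⟩
      · rw [isDiscreteMeasure_iff_of_zonal hn hμ] at hd
        filter_upwards [measure_eq_zero_iff_ae_notMem.1 hd] with w hw
        simp only [mem_compl_iff, not_not, mem_insert_iff, mem_singleton_iff] at hw
        rcases hw with rfl | rfl
        · rw [hue]
        · rw [coe_neg_sphere, map_neg, map_neg_eq_map, hue]
      · refine ae_of_all _ fun w => ?_
        rw [hr u, show ϑ w = (sphereMap ϑ w : Rn n) from rfl, hr]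
    rw [average_congr hae, average_const, hue] at hav
    exact (Real.rpow_left_inj (hH u).le (hF u).le (by linarith)).1 hav

end Comparison

/-! ### The Gauss map and the surface area measure -/

theorem isCompact_normalBundle {n : ℕ} {K : Set (Rn n)} (hK : IsCompact K) :
    IsCompact {q : Rn n × Sph n | q.1 ∈ frontier K ∧ IsOuterNormal K q.1 q.2} := by
  have h1 : IsCompact (frontier K ×ˢ (univ : Set (Sph n))) :=
    (hK.of_isClosed_subset isClosed_frontier hK.isClosed.frontier_subset).prod isCompact_univ
  refine h1.of_isClosed_subset ?_ fun q hq => ⟨hq.1, mem_univ _⟩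
  refine (isClosed_frontier.preimage continuous_fst).inter ?_
  have heq : {q : Rn n × Sph n | IsOuterNormal K q.1 q.2} =
      ⋂ y ∈ K, {q : Rn n × Sph n | ⟪(q.2 : Rn n), y⟫ ≤ ⟪(q.2 : Rn n), q.1⟫} := by
    ext q
    simp [IsOuterNormal]
  change IsClosed {q : Rn n × Sph n | IsOuterNormal K q.1 q.2}
  rw [heq]
  exact isClosed_biInter fun y _ => isClosed_le (by fun_prop) (by fun_prop)

theorem isOuterNormal_gaussMap {n : ℕ} {K : Set (Rn n)} (x : regularBoundary K) :
    IsOuterNormal K x (gaussMap K x) :=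
  x.2.2.choose_spec.1

theorem eq_gaussMap {n : ℕ} {K : Set (Rn n)} (x : regularBoundary K) {v : Sph n}
    (hv : IsOuterNormal K x v) : v = gaussMap K x :=
  x.2.2.choose_spec.2 v hv

/-- The closed-graph argument: preimages of closed sets are traces of projections of compact parts
of the normal bundle, by uniqueness of the normal. -/
theorem continuous_gaussMap {n : ℕ} {K : Set (Rn n)} (hK : IsCompact K) :
    Continuous (gaussMap K) := by
  refine continuous_iff_isClosed.2 fun T hT => ?_
  have h1 : IsCompact (Prod.fst '' ({q : Rn n × Sph n | q.1 ∈ frontier K ∧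
      IsOuterNormal K q.1 q.2} ∩ Prod.snd ⁻¹' T)) :=
    ((isCompact_normalBundle hK).inter_right (hT.preimage continuous_snd)).image continuous_fst
  convert h1.isClosed.preimage (continuous_subtype_val (p := fun x => x ∈ regularBoundary K))
    using 1
  ext x
  constructor
  · intro hx
    exact ⟨(x, gaussMap K x), ⟨⟨x.2.1, isOuterNormal_gaussMap x⟩, hx⟩, rfl⟩
  · rintro ⟨⟨y, v⟩, ⟨⟨-, hv⟩, hvT⟩, hyx⟩
    have hyx : y = x := hyx
    subst hyx
    have := eq_gaussMap x hv
    rw [mem_preimage, ← this]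
    exact hvT

/-- The boundary points with several normals form the countable union, over `k`, of those with two
normals at distance at least `1 / (k + 1)`; each of these sets is a projection of a compact set. -/
theorem measurableSet_regularBoundary {n : ℕ} {K : Set (Rn n)} (hK : IsCompact K) :
    MeasurableSet (regularBoundary K) := by
  set C := {q : Rn n × Sph n | q.1 ∈ frontier K ∧ IsOuterNormal K q.1 q.2} with hC
  have hCc : IsCompact C := isCompact_normalBundle hK
  let D : ℕ → Set (Rn n × Sph n × Sph n) := fun k =>
    {q | (q.1, q.2.1) ∈ C ∧ (q.1, q.2.2) ∈ C ∧ 1 / ((k : ℝ) + 1) ≤ dist q.2.1 q.2.2}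
  have hD : ∀ k, IsCompact (D k) := by
    intro k
    have h1 : IsCompact (frontier K ×ˢ ((univ : Set (Sph n)) ×ˢ (univ : Set (Sph n)))) :=
      (hK.of_isClosed_subset isClosed_frontier hK.isClosed.frontier_subset).prod
        (isCompact_univ.prod isCompact_univ)
    refine h1.of_isClosed_subset ?_ fun q hq => ⟨hq.1.1, mem_univ _, mem_univ _⟩
    have c1 : Continuous fun q : Rn n × Sph n × Sph n => (q.1, q.2.1) := by fun_prop
    have c2 : Continuous fun q : Rn n × Sph n × Sph n => (q.1, q.2.2) := by fun_prop
    have c3 : Continuous fun q : Rn n × Sph n × Sph n => dist q.2.1 q.2.2 := by fun_prop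
    exact (hCc.isClosed.preimage c1).inter ((hCc.isClosed.preimage c2).inter
      (isClosed_le continuous_const c3))
  have heq : regularBoundary K = Prod.fst '' C \ ⋃ k, Prod.fst '' D k := by
    ext x
    constructor
    · rintro ⟨hx, v, hv, huniq⟩
      refine ⟨⟨(x, v), ⟨hx, hv⟩, rfl⟩, ?_⟩
      simp only [mem_iUnion, not_exists]
      rintro k ⟨⟨y, v₁, v₂⟩, ⟨h1, h2, h3⟩, rfl⟩
      rw [huniq v₁ h1.2, huniq v₂ h2.2, dist_self] at h3
      have : (0 : ℝ) < 1 / ((k : ℝ) + 1) := by positivity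
      linarith
    · rintro ⟨⟨⟨y, v⟩, ⟨hy, hv⟩, rfl⟩, hnot⟩
      refine ⟨hy, v, hv, fun v' hv' => ?_⟩
      by_contra hne
      obtain ⟨k, hk⟩ := exists_nat_one_div_lt (dist_pos.2 hne)
      exact hnot (mem_iUnion.2 ⟨k, (y, v', v), ⟨⟨hy, hv'⟩, ⟨hy, hv⟩, hk.le⟩, rfl⟩)
  rw [heq]
  exact (hCc.image continuous_fst).isClosed.measurableSet.diff
    (MeasurableSet.iUnion fun k => ((hD k).image continuous_fst).isClosed.measurableSet)

theorem surfaceAreaMeasure_apply {n : ℕ} {K : Set (Rn n)} (hK : IsCompact K) {s : Set (Sph n)}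
    (hs : MeasurableSet s) : surfaceAreaMeasure K s =
      (μHE[n - 1] : Measure (Rn n)) (Subtype.val '' (gaussMap K ⁻¹' s)) := by
  rw [surfaceAreaMeasure, Measure.map_apply (continuous_gaussMap hK).measurable hs,
    comap_subtype_coe_apply (measurableSet_regularBoundary hK)]

theorem finrank_orthogonal_span_singleton {n : ℕ} (u : Sph n) :
    Module.finrank ℝ (ℝ ∙ (u : Rn n))ᗮ = n - 1 := by
  have h := Submodule.finrank_add_finrank_orthogonal (ℝ ∙ (u : Rn n))
  rw [finrank_span_singleton (ne_zero_of_mem_unit_sphere u), finrank_euclideanSpace,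
    Fintype.card_fin] at h
  omega

/-- The part of `K` on which some outer unit normal is close to `w` has finite area. -/
theorem hausdorffMeasure_lt_top_of_normal {n : ℕ} {K : Set (Rn n)} (hK : IsCompact K)
    (w : Sph n) :
    (μH[((n - 1 : ℕ) : ℝ)] : Measure (Rn n))
      {x | x ∈ K ∧ ∃ v : Sph n, IsOuterNormal K x v ∧ 1 / 2 < ⟪(v : Rn n), (w : Rn n)⟫} < ⊤ := by
  set A := {x | x ∈ K ∧ ∃ v : Sph n, IsOuterNormal K x v ∧ 1 / 2 < ⟪(v : Rn n), (w : Rn n)⟫}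
    with hA
  let E : Submodule ℝ (Rn n) := (ℝ ∙ (w : Rn n))ᗮ
  let P : Rn n →L[ℝ] E := E.orthogonalProjectionOnto
  have hdecomp : ∀ d : Rn n, d = ⟪(w : Rn n), d⟫ • (w : Rn n) + (P d : Rn n) := by
    intro d
    have h := (ℝ ∙ (w : Rn n)).starProjection_add_starProjection_orthogonal d
    rw [Submodule.starProjection_unit_singleton ℝ (by simp : ‖(w : Rn n)‖ = 1)] at h
    exact h.symm
  -- The normal `v` at `x` has `v · (y - x) ≤ 0` and `v · w > 1/2`, so the height difference is at
  -- most twice the horizontal distance. By symmetry `P` is injective on `A`, with inverse of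
  -- Lipschitz constant `2 + 1 = 3`.
  have hone : ∀ x ∈ A, ∀ y ∈ A, ⟪(w : Rn n), y - x⟫ ≤ 2 * ‖P (y - x)‖ := by
    rintro x ⟨-, v, hv, hvw⟩ y ⟨hy, -⟩
    have h1 : ⟪(v : Rn n), y - x⟫ ≤ 0 := by rw [inner_sub_right]; linarith [hv y hy]
    rw [hdecomp (y - x), inner_add_right, real_inner_smul_right] at h1
    have h2 : -‖P (y - x)‖ ≤ ⟪(v : Rn n), (P (y - x) : Rn n)⟫ := by
      have := abs_real_inner_le_norm (v : Rn n) (P (y - x) : Rn n)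
      rw [norm_eq_of_mem_sphere, one_mul] at this
      exact (abs_le.1 this).1
    by_contra! hcon
    nlinarith [norm_nonneg (P (y - x))]
  have hanti : AntilipschitzWith 3 (fun x : A => P x) := by
    refine AntilipschitzWith.of_le_mul_dist fun x y => ?_
    have h1 := hone x x.2 y y.2
    have h2 := hone y y.2 x x.2
    have h3 : ‖P ((y : Rn n) - x)‖ = ‖P ((x : Rn n) - y)‖ := by
      rw [← neg_sub, map_neg, norm_neg]
    have h4 : ⟪(w : Rn n), (y : Rn n) - x⟫ = -⟪(w : Rn n), (x : Rn n) - y⟫ := by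
      rw [← inner_neg_right, neg_sub]
    rw [Subtype.dist_eq, dist_eq_norm, dist_eq_norm, ← map_sub]
    have h5 : ‖(x : Rn n) - y‖ ≤ |⟪(w : Rn n), (x : Rn n) - y⟫| + ‖P ((x : Rn n) - y)‖ := by
      nth_rewrite 1 [hdecomp ((x : Rn n) - y)]
      refine (norm_add_le _ _).trans ?_
      rw [norm_smul, norm_eq_of_mem_sphere, mul_one, Real.norm_eq_abs]
      rfl
    have h6 : |⟪(w : Rn n), (x : Rn n) - y⟫| ≤ 2 * ‖P ((x : Rn n) - y)‖ := by
      rw [abs_le]; constructor <;> linarith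
    push_cast
    linarith
  obtain ⟨R, hR⟩ := (hK.image P.continuous).isBounded.subset_closedBall 0
  have hle := hanti.le_hausdorffMeasure_image (d := ((n - 1 : ℕ) : ℝ)) (by positivity) univ
  have hval := isometry_subtype_coe.hausdorffMeasure_image (X := A) (Y := Rn n)
    (d := ((n - 1 : ℕ) : ℝ)) (f := Subtype.val) (Or.inl (by positivity)) univ
  rw [image_univ, Subtype.range_coe] at hval
  rw [hval]
  refine hle.trans_lt (ENNReal.mul_lt_top (ENNReal.rpow_lt_top_of_nonneg (by positivity)
    (by simp)) ?_)
  refine (measure_mono (t := closedBall (0 : E) R) ?_).trans_lt ?_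
  · rintro _ ⟨x, -, rfl⟩
    exact hR ⟨x, x.2.1, rfl⟩
  · have hfr : n - 1 = Module.finrank ℝ E := (finrank_orthogonal_span_singleton w).symm
    rw [hfr]
    exact (isCompact_closedBall (0 : E) R).measure_lt_top

theorem isFiniteMeasure_surfaceAreaMeasure {n : ℕ} {K : Set (Rn n)} (hK : IsCompact K) :
    IsFiniteMeasure (surfaceAreaMeasure K) := by
  refine ⟨?_⟩
  rw [surfaceAreaMeasure_apply hK MeasurableSet.univ, Measure.euclideanHausdorffMeasure_def,
    Measure.smul_apply]
  refine ENNReal.mul_lt_top (by simp) ?_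
  obtain ⟨t, ht⟩ := isCompact_univ.elim_finite_subcover
    (fun w : Sph n => {v : Sph n | 1 / 2 < ⟪(v : Rn n), (w : Rn n)⟫})
    (fun w => isOpen_lt continuous_const (by fun_prop)) (fun v _ => mem_iUnion.2 ⟨v, by
      simp only [mem_ofPred_eq, real_inner_self_eq_norm_sq, norm_eq_of_mem_sphere]
      norm_num⟩)
  refine (measure_mono (t := ⋃ w ∈ t, {x | x ∈ K ∧ ∃ v : Sph n, IsOuterNormal K x v ∧
    1 / 2 < ⟪(v : Rn n), (w : Rn n)⟫}) ?_).trans_lt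
      ((measure_biUnion_finset_le _ _).trans_lt (ENNReal.sum_lt_top.2 fun w _ =>
        hausdorffMeasure_lt_top_of_normal hK w))
  rintro _ ⟨x, -, rfl⟩
  obtain ⟨w, hw, hvw⟩ := mem_iUnion₂.1 (ht (mem_univ (gaussMap K x)))
  exact mem_iUnion₂.2 ⟨w, hw, hK.isClosed.frontier_subset x.2.1, gaussMap K x,
    isOuterNormal_gaussMap x, hvw⟩

/-! ### Supporting hyperplanes and the gauge function -/

theorem exists_isOuterNormal {n : ℕ} {K : Set (Rn n)} (hK : Convex ℝ K)
    (h0 : (0 : Rn n) ∈ interior K) {x : Rn n} (hx : x ∈ frontier K) :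
    ∃ v : Sph n, IsOuterNormal K x v := by
  obtain ⟨f, hf⟩ := geometric_hahn_banach_open_point hK.interior isOpen_interior hx.2
  let y : Rn n := (InnerProductSpace.toDual ℝ (Rn n)).symm f
  have hy : ∀ z, ⟪y, z⟫ = f z := fun z => InnerProductSpace.toDual_symm_apply
  have hy0 : y ≠ 0 := by
    intro h
    have h1 := hf 0 h0
    rw [← hy, ← hy, h, inner_zero_left, inner_zero_left] at h1
    exact lt_irrefl _ h1
  obtain ⟨v, hv⟩ := exists_eq_norm_smul hy0
  have hcl : ∀ z ∈ K, ⟪y, z⟫ ≤ ⟪y, x⟫ := by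
    intro z hz
    have hz' : z ∈ closure (interior K) := by
      rw [hK.closure_interior_eq_closure_of_nonempty_interior ⟨0, h0⟩]
      exact subset_closure hz
    refine closure_minimal (t := {z | ⟪y, z⟫ ≤ ⟪y, x⟫}) (fun w hw => ?_)
      (isClosed_le (by fun_prop) (by fun_prop)) hz'
    simp only [mem_ofPred_eq, hy]
    exact (hf w hw).le
  refine ⟨v, fun z hz => ?_⟩
  have h2 := hcl z hz
  rw [hv, real_inner_smul_left, real_inner_smul_left] at h2
  exact le_of_mul_le_mul_left h2 (norm_pos_iff.2 hy0)

theorem le_inner_of_isOuterNormal {n : ℕ} {K : Set (Rn n)} {r : ℝ} (hr : 0 ≤ r)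
    (hrK : closedBall (0 : Rn n) r ⊆ K) {x : Rn n} {v : Sph n} (hv : IsOuterNormal K x v) :
    r ≤ ⟪(v : Rn n), x⟫ := by
  have h := hv (r • (v : Rn n)) (hrK (by simp [norm_smul, abs_of_nonneg hr]))
  simpa [real_inner_smul_right, real_inner_self_eq_norm_sq] using h

/-- An outer normal of `K` at a boundary point bounds the gauge function from below. -/
theorem inner_le_mul_gauge {n : ℕ} {K : Set (Rn n)} (hK : IsCompact K) (hKc : Convex ℝ K)
    (h0 : (0 : Rn n) ∈ interior K) {x : Rn n} {v : Sph n} (hv : IsOuterNormal K x v)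
    (w : Rn n) : ⟪(v : Rn n), w⟫ ≤ ⟪(v : Rn n), x⟫ * gauge K w := by
  have hnhds : K ∈ nhds (0 : Rn n) := mem_interior_iff_mem_nhds.1 h0
  rcases eq_or_ne w 0 with rfl | hw
  · simp
  have hg : 0 < gauge K w :=
    (gauge_pos (absorbent_nhds_zero hnhds)
      (NormedSpace.isVonNBounded_iff ℝ |>.2 hK.isBounded)).2 hw
  have hmem : (gauge K w)⁻¹ • w ∈ K := by
    have : gauge K ((gauge K w)⁻¹ • w) ≤ 1 := by
      rw [gauge_smul_of_nonneg (inv_nonneg.2 hg.le), smul_eq_mul, inv_mul_cancel₀ hg.ne']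
    rwa [gauge_le_one_iff_mem_closure hKc hnhds, hK.isClosed.closure_eq] at this
  have h := hv _ hmem
  rw [real_inner_smul_right, inv_mul_le_iff₀ hg] at h
  linarith

/-- If the gauge of `K` is differentiable along `u^⊥` at `u + y`, then the boundary point of `K` on
the ray through `u + y` has at most one outer unit normal. -/
theorem isOuterNormal_unique_of_differentiableAt {n : ℕ} {K : Set (Rn n)} (hK : IsCompact K)
    (hKc : Convex ℝ K) {r : ℝ} (hr : 0 < r) (hrK : closedBall (0 : Rn n) r ⊆ K) (u : Sph n)
    {y : (ℝ ∙ (u : Rn n))ᗮ}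
    (hd : DifferentiableAt ℝ (fun y : (ℝ ∙ (u : Rn n))ᗮ => gauge K ((u : Rn n) + y)) y)
    {x : Rn n} (hx : gauge K ((u : Rn n) + y) • x = (u : Rn n) + y) {v v' : Sph n}
    (hv : IsOuterNormal K x v) (hv' : IsOuterNormal K x v') : v = v' := by
  let E : Submodule ℝ (Rn n) := (ℝ ∙ (u : Rn n))ᗮ
  have h0 : (0 : Rn n) ∈ interior K :=
    mem_interior.2 ⟨ball 0 r, ball_subset_closedBall.trans hrK, isOpen_ball, mem_ball_self hr⟩
  have key : ∀ v : Sph n, IsOuterNormal K x v → ∀ w : E,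
      ⟪(v : Rn n), (w : Rn n)⟫ = ⟪(v : Rn n), x⟫ *
        fderiv ℝ (fun y : E => gauge K ((u : Rn n) + y)) y w := by
    intro v hv w
    let β : ℝ := ⟪(v : Rn n), x⟫
    let L : E →L[ℝ] ℝ := (innerSL ℝ (v : Rn n)).comp E.subtypeL
    -- The supporting hyperplane makes `φ` nonnegative, and it vanishes at the given point, so its
    -- derivative there is zero. This determines `v / β` on `u^⊥`.
    let φ : E → ℝ := fun y => β * gauge K ((u : Rn n) + y) - (L y + ⟪(v : Rn n), (u : Rn n)⟫)
    have hφ : HasFDerivAt φ (β • fderiv ℝ (fun y : E => gauge K ((u : Rn n) + y)) y - L) y :=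
      (hd.hasFDerivAt.const_mul β).sub (L.hasFDerivAt.add_const _)
    have hLu : ∀ z : E, L z + ⟪(v : Rn n), (u : Rn n)⟫ = ⟪(v : Rn n), (u : Rn n) + z⟫ := by
      intro z
      rw [inner_add_right, add_comm]
      rfl
    have hmin : IsLocalMin φ y := by
      refine Filter.Eventually.of_forall fun z => ?_
      have h1 := inner_le_mul_gauge hK hKc h0 hv ((u : Rn n) + z)
      have h2 : φ y = 0 := by
        simp only [φ, hLu]
        nth_rewrite 2 [← hx]
        rw [real_inner_smul_right]
        ring
      rw [h2]
      simp only [φ, hLu]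
      linarith
    have h3 := hmin.hasFDerivAt_eq_zero hφ
    have h4 := congrArg (fun T : E →L[ℝ] ℝ => T w) h3
    simp only [sub_apply, smul_apply, smul_eq_mul,
      zero_apply] at h4
    exact (sub_eq_zero.1 h4).symm
  have hβ : 0 < ⟪(v : Rn n), x⟫ := hr.trans_le (le_inner_of_isOuterNormal hr.le hrK hv)
  have hβ' : 0 < ⟪(v' : Rn n), x⟫ := hr.trans_le (le_inner_of_isOuterNormal hr.le hrK hv')
  set β := ⟪(v : Rn n), x⟫ with hβdef
  set β' := ⟪(v' : Rn n), x⟫ with hβdef'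
  have huu : ⟪(u : Rn n), (u : Rn n)⟫ = 1 := by simp
  have hz : ∀ z : Rn n, z - ⟪(u : Rn n), z⟫ • ((u : Rn n) + y) ∈ E := by
    intro z
    refine Submodule.mem_orthogonal_singleton_iff_inner_right.2 ?_
    rw [inner_sub_right, real_inner_smul_right, inner_add_right, huu,
      Submodule.mem_orthogonal_singleton_iff_inner_right.1 y.2]
    ring
  -- The vector `u + y` and `u^⊥` span the space, and `v / β` and `v' / β'` agree on both.
  have hvv : β' • (v : Rn n) = β • (v' : Rn n) := by
    refine ext_inner_right ℝ fun z => ?_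
    have e1 := key v hv ⟨_, hz z⟩
    have e2 := key v' hv' ⟨_, hz z⟩
    rw [← hβdef] at e1
    rw [← hβdef'] at e2
    simp only [inner_sub_right, real_inner_smul_right] at e1 e2
    rw [show ⟪(v : Rn n), (u : Rn n) + y⟫ = gauge K ((u : Rn n) + y) * β by
      rw [hβdef, ← real_inner_smul_right, hx]] at e1
    rw [show ⟪(v' : Rn n), (u : Rn n) + y⟫ = gauge K ((u : Rn n) + y) * β' by
      rw [hβdef', ← real_inner_smul_right, hx]] at e2
    rw [real_inner_smul_left, real_inner_smul_left]
    linear_combination β' * e1 - β * e2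
  have hββ : β' = β := by
    have := congrArg norm hvv
    rwa [norm_smul, norm_smul, norm_eq_of_mem_sphere, norm_eq_of_mem_sphere, mul_one, mul_one,
      Real.norm_of_nonneg hβ.le, Real.norm_of_nonneg hβ'.le] at this
  rw [hββ] at hvv
  exact Subtype.ext (smul_right_injective _ hβ.ne' hvv)

/-- The radial projection to a hyperplane is Lipschitz away from the parallel hyperplane through
the origin. -/
theorem lipschitzOnWith_radial {n : ℕ} (u : Sph n) {ε R : ℝ} (hε : 0 < ε) (hR : 0 ≤ R) :
    LipschitzOnWith (1 / ε + R / ε ^ 2).toNNReal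
      (fun x : Rn n => (ℝ ∙ (u : Rn n))ᗮ.orthogonalProjectionOnto (⟪(u : Rn n), x⟫⁻¹ • x))
      {x | ε ≤ ⟪(u : Rn n), x⟫ ∧ ‖x‖ ≤ R} := by
  refine LipschitzOnWith.of_dist_le_mul ?_
  rintro x ⟨hx, -⟩ y ⟨hy, hyR⟩
  rw [Real.coe_toNNReal _ (by positivity), dist_eq_norm, dist_eq_norm, ← map_sub]
  refine (Submodule.norm_orthogonalProjectionOnto_apply_le _ _).trans ?_
  set s := ⟪(u : Rn n), x⟫ with hs
  set t := ⟪(u : Rn n), y⟫ with ht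
  have hs0 : 0 < s := hε.trans_le hx
  have ht0 : 0 < t := hε.trans_le hy
  have h1 : s⁻¹ • x - t⁻¹ • y = s⁻¹ • (x - y) + ((t - s) * (s⁻¹ * t⁻¹)) • y := by
    rw [smul_sub, show (t - s) * (s⁻¹ * t⁻¹) = s⁻¹ - t⁻¹ by field_simp, sub_smul]
    abel
  have h2 : |t - s| ≤ ‖x - y‖ := by
    have := abs_real_inner_le_norm (u : Rn n) (x - y)
    rwa [inner_sub_right, norm_eq_of_mem_sphere, one_mul, abs_sub_comm] at this
  have h3 : s⁻¹ ≤ 1 / ε := by rw [one_div]; exact inv_anti₀ hε hx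
  have h4 : t⁻¹ ≤ 1 / ε := by rw [one_div]; exact inv_anti₀ hε hy
  rw [h1]
  refine (norm_add_le _ _).trans ?_
  rw [norm_smul, norm_smul, Real.norm_of_nonneg (inv_nonneg.2 hs0.le), norm_mul,
    Real.norm_of_nonneg (by positivity : 0 ≤ s⁻¹ * t⁻¹), Real.norm_eq_abs, add_mul]
  have h5 : |t - s| * (s⁻¹ * t⁻¹) * ‖y‖ ≤ ‖x - y‖ * (1 / ε * (1 / ε)) * R := by gcongr
  have h6 : s⁻¹ * ‖x - y‖ ≤ 1 / ε * ‖x - y‖ := by gcongr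
  have h7 : ‖x - y‖ * (1 / ε * (1 / ε)) * R = R / ε ^ 2 * ‖x - y‖ := by field_simp
  linarith

/-- The surface area measure of a convex body is not concentrated on a great subsphere. -/
theorem surfaceAreaMeasure_inner_ne_zero_pos {n : ℕ} {K : Set (Rn n)} (hK : IsCompact K)
    (hKc : Convex ℝ K) (h0 : (0 : Rn n) ∈ interior K) (u : Sph n) :
    0 < surfaceAreaMeasure K {v | ⟪(u : Rn n), (v : Rn n)⟫ ≠ 0} := by
  have hmeas : MeasurableSet {v : Sph n | ⟪(u : Rn n), (v : Rn n)⟫ ≠ 0} :=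
    (isOpen_ne_fun (by fun_prop) continuous_const).measurableSet
  have hnhds : K ∈ nhds (0 : Rn n) := mem_interior_iff_mem_nhds.1 h0
  obtain ⟨r, hr, hrK⟩ := nhds_basis_closedBall.mem_iff.1 hnhds
  obtain ⟨R, hR, hKR⟩ := hK.isBounded.subset_closedBall_lt 0 0
  have habs := absorbent_nhds_zero (𝕜 := ℝ) hnhds
  have hgpos : ∀ {w : Rn n}, w ≠ 0 → 0 < gauge K w := fun hw =>
    (gauge_pos habs (NormedSpace.isVonNBounded_iff ℝ |>.2 hK.isBounded)).2 hw
  have hgle : ∀ w, r * gauge K w ≤ ‖w‖ := fun w =>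
    mul_gauge_le_norm (ball_subset_closedBall.trans hrK)
  have hgge : ∀ w, ‖w‖ ≤ R * gauge K w := fun w => by
    have h := le_gauge_of_subset_closedBall (x := w) habs hR.le hKR
    rw [div_le_iff₀ hR] at h
    linarith
  let E : Submodule ℝ (Rn n) := (ℝ ∙ (u : Rn n))ᗮ
  have huE : ∀ y : E, ⟪(u : Rn n), (y : Rn n)⟫ = 0 := fun y =>
    Submodule.mem_orthogonal_singleton_iff_inner_right.1 y.2
  have huu : ⟪(u : Rn n), (u : Rn n)⟫ = 1 := by simp
  obtain ⟨C, hC⟩ := hKc.lipschitz_gauge hnhds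
  have hG : LipschitzWith C (fun y : E => gauge K ((u : Rn n) + y)) := by
    refine LipschitzWith.of_dist_le_mul fun y z => ?_
    refine (hC.dist_le_mul _ _).trans_eq ?_
    rw [dist_add_left, Subtype.dist_eq]
  -- The bound `δ ≤ 1` keeps `‖u + y‖ ≤ 2`, so boundary points on these rays have height at least `r
  -- / 2` over `u^⊥`; `δ R < r` forces their normals to satisfy `v · u > 0`.
  let δ : ℝ := min 1 (r / (2 * R))
  have hδ : 0 < δ := lt_min one_pos (by positivity)
  have hδ1 : δ ≤ 1 := min_le_left _ _
  have hδR : δ * R < r := by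
    have : δ ≤ r / (2 * R) := min_le_right _ _
    rw [le_div_iff₀ (by positivity)] at this
    linarith [mul_pos hδ hR]
  let D : Set E := {y | y ∈ ball (0 : E) δ ∧
    DifferentiableAt ℝ (fun y : E => gauge K ((u : Rn n) + y)) y}
  have hDpos : 0 < (μH[((n - 1 : ℕ) : ℝ)] : Measure E) D := by
    rw [show n - 1 = Module.finrank ℝ E from (finrank_orthogonal_span_singleton u).symm]
    have hae := hG.ae_differentiableAt (μ := (μH[(Module.finrank ℝ E : ℝ)] : Measure E))
    have : (μH[(Module.finrank ℝ E : ℝ)] : Measure E) D =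
        (μH[(Module.finrank ℝ E : ℝ)] : Measure E) (ball (0 : E) δ) := by
      refine measure_congr ?_
      filter_upwards [hae] with y hy
      exact propext ⟨fun h => h.1, fun h => ⟨h, hy⟩⟩
    rw [this]
    exact measure_ball_pos _ _ hδ
  set A : Set (Rn n) := Subtype.val '' (gaussMap K ⁻¹' {v | ⟪(u : Rn n), (v : Rn n)⟫ ≠ 0}) with hA
  let ψ : Rn n → E := fun x => E.orthogonalProjectionOnto (⟪(u : Rn n), x⟫⁻¹ • x)
  let X : Set (Rn n) := {x | r / 2 ≤ ⟪(u : Rn n), x⟫ ∧ ‖x‖ ≤ R}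
  -- By Rademacher's theorem `D` has positive measure. It lies in the image of part of `A` under a
  -- map that is Lipschitz on `X`, so `A` cannot be null.
  have hsub : D ⊆ ψ '' (A ∩ X) := by
    rintro y ⟨hyδ, hyd⟩
    set z : Rn n := (u : Rn n) + y with hz
    have huz : ⟪(u : Rn n), z⟫ = 1 := by rw [hz, inner_add_right, huu, huE, add_zero]
    have hz0 : z ≠ 0 := fun h => by rw [h, inner_zero_right] at huz; exact zero_ne_one huz
    have hg := hgpos hz0
    have hyδ' : ‖(y : Rn n)‖ < δ := by simpa using hyδ
    have hz2 : ‖z‖ ≤ 2 := by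
      refine (norm_add_le _ _).trans ?_
      rw [norm_eq_of_mem_sphere]
      linarith
    have hz1 : 1 ≤ ‖z‖ := by
      have h := real_inner_le_norm (u : Rn n) z
      rwa [huz, norm_eq_of_mem_sphere, one_mul] at h
    set x : Rn n := (gauge K z)⁻¹ • z with hx
    have hgx : gauge K z • x = z := by rw [hx, smul_inv_smul₀ hg.ne']
    have hgx1 : gauge K x = 1 := by
      rw [hx, gauge_smul_of_nonneg (inv_nonneg.2 hg.le), smul_eq_mul, inv_mul_cancel₀ hg.ne']
    have hxf : x ∈ frontier K := (gauge_eq_one_iff_mem_frontier hKc hnhds).1 hgx1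
    obtain ⟨v, hv⟩ := exists_isOuterNormal hKc h0 hxf
    have hxr : x ∈ regularBoundary K := ⟨hxf, v, hv, fun v' hv' =>
      isOuterNormal_unique_of_differentiableAt hK hKc hr hrK u hyd hgx hv' hv⟩
    have hux : ⟪(u : Rn n), x⟫ = (gauge K z)⁻¹ := by rw [hx, real_inner_smul_right, huz, mul_one]
    refine ⟨x, ⟨⟨⟨x, hxr⟩, ?_, rfl⟩, ?_, ?_⟩, ?_⟩
    · rw [mem_preimage, ← eq_gaussMap ⟨x, hxr⟩ hv]
      have h1 : r ≤ ⟪(v : Rn n), x⟫ := le_inner_of_isOuterNormal hr.le hrK hv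
      have h2 : ⟪(v : Rn n), z⟫ = gauge K z * ⟪(v : Rn n), x⟫ := by
        rw [← real_inner_smul_right, hgx]
      have h3 : ⟪(v : Rn n), z⟫ = ⟪(v : Rn n), (u : Rn n)⟫ + ⟪(v : Rn n), (y : Rn n)⟫ := by
        rw [hz, inner_add_right]
      have h4 : ⟪(v : Rn n), (y : Rn n)⟫ ≤ ‖(y : Rn n)‖ := by
        have h := real_inner_le_norm (v : Rn n) y
        rwa [norm_eq_of_mem_sphere, one_mul] at h
      have h5 : 1 ≤ R * gauge K z := hz1.trans (hgge z)
      have h6 : gauge K z * r ≤ gauge K z * ⟪(v : Rn n), x⟫ :=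
        mul_le_mul_of_nonneg_left h1 hg.le
      have h7 : δ < gauge K z * r := by nlinarith
      -- Here `v · z ≥ r * gauge K z > δ`, while `v · y ≤ ‖y‖ < δ`.
      have h8 : 0 < ⟪(v : Rn n), (u : Rn n)⟫ := by linarith
      simp only [mem_ofPred_eq]
      rw [real_inner_comm]
      exact h8.ne'
    · rw [hux, le_inv_comm₀ (by positivity) hg, inv_div, le_div_iff₀ hr]
      linarith [hgle z]
    · simpa using hKR (hK.isClosed.frontier_subset hxf)
    · simp only [ψ]
      rw [hux, inv_inv, hgx]
      have h1 : E.orthogonalProjectionOnto (u : Rn n) = 0 :=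
        Submodule.orthogonalProjectionOnto_orthogonalComplement_singleton_eq_zero _
      rw [hz, map_add, h1, zero_add, Submodule.orthogonalProjectionOnto_mem_subspace_eq_self]
  have hlip := (lipschitzOnWith_radial u (half_pos hr) hR.le).mono (inter_subset_right (s := A))
  have hle := (measure_mono hsub).trans
    (hlip.hausdorffMeasure_image_le (d := ((n - 1 : ℕ) : ℝ)) (by positivity))
  rw [surfaceAreaMeasure_apply hK hmeas, Measure.euclideanHausdorffMeasure_def,
    Measure.smul_apply]
  refine pos_iff_ne_zero.2 fun hzero => ?_
  have hA0 : (μH[((n - 1 : ℕ) : ℝ)] : Measure (Rn n)) A = 0 := by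
    rw [← hA, ENNReal.smul_def, smul_eq_mul, mul_eq_zero] at hzero
    refine hzero.resolve_left ?_
    exact ENNReal.coe_ne_zero.2
      (Measure.addHaarScalarFactor_volume_hausdorffMeasure_ne_zero (n - 1))
  rw [measure_mono_null inter_subset_left hA0, mul_zero] at hle
  exact (hDpos.trans_le hle).ne rfl

/-! ### The `L_p` surface area measure -/

theorem continuous_supportFn {n : ℕ} {K : Set (Rn n)} (hK : IsCompact K) :
    Continuous (supportFn K) :=
  hK.continuous_sSup (f := fun u x : Rn n => ⟪u, x⟫) (by fun_prop)

theorem supportFn_pos {n : ℕ} {K : Set (Rn n)} (hK : IsCompact K)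
    (h0 : (0 : Rn n) ∈ interior K) (v : Sph n) : 0 < supportFn K v := by
  obtain ⟨r, hr, hrK⟩ := nhds_basis_closedBall.mem_iff.1 (mem_interior_iff_mem_nhds.1 h0)
  refine hr.trans_le (le_csSup (hK.image (f := fun x : Rn n => ⟪(v : Rn n), x⟫)
    (by fun_prop)).bddAbove ⟨r • (v : Rn n), hrK (by simp [norm_smul, abs_of_pos hr]), ?_⟩)
  simp [real_inner_smul_right]

theorem continuous_supportFn_rpow {n : ℕ} {K : Set (Rn n)} (hK : IsCompact K)
    (h0 : (0 : Rn n) ∈ interior K) (q : ℝ) : Continuous fun v : Sph n => supportFn K v ^ q :=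
  ((continuous_supportFn hK).comp continuous_subtype_val).rpow_const
    fun v => Or.inl (supportFn_pos hK h0 v).ne'

theorem isFiniteMeasure_lpSurfaceAreaMeasure {n : ℕ} (p : ℝ) {K : Set (Rn n)} (hK : IsCompact K)
    (h0 : (0 : Rn n) ∈ interior K) : IsFiniteMeasure (lpSurfaceAreaMeasure p K) := by
  have := isFiniteMeasure_surfaceAreaMeasure hK
  exact isFiniteMeasure_withDensity_ofReal
    (integrable_of_continuous (continuous_supportFn_rpow hK h0 (1 - p)) _).2

theorem surfaceAreaMeasure_absolutelyContinuous {n : ℕ} (p : ℝ) {K : Set (Rn n)}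
    (hK : IsCompact K) (h0 : (0 : Rn n) ∈ interior K) :
    surfaceAreaMeasure K ≪ lpSurfaceAreaMeasure p K := by
  refine withDensity_absolutelyContinuous'
    (continuous_supportFn_rpow hK h0 (1 - p)).measurable.ennreal_ofReal.aemeasurable
    (ae_of_all _ fun v => ?_)
  exact (ENNReal.ofReal_pos.2 (Real.rpow_pos_of_pos (supportFn_pos hK h0 v) _)).ne'

theorem lpCosine_pos {n : ℕ} {p : ℝ} (hp : 1 ≤ p) {ν : Measure (Sph n)} [IsFiniteMeasure ν]
    {u : Sph n} (hν : ν {v | ⟪(u : Rn n), (v : Rn n)⟫ ≠ 0} ≠ 0) : 0 < lpCosine p hp ν u := by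
  rw [lpCosine_apply]
  have hp0 : 0 < p := by linarith
  have hcont : Continuous fun v : Sph n => |⟪(u : Rn n), (v : Rn n)⟫| ^ p :=
    Continuous.rpow_const (by fun_prop) fun _ => Or.inr hp0.le
  refine Real.rpow_pos_of_pos ?_ _
  rw [integral_pos_iff_support_of_nonneg (fun v => by positivity)
    (integrable_of_continuous hcont ν)]
  refine pos_iff_ne_zero.2 ?_
  convert hν using 2
  ext v
  simp [Function.mem_support, Real.rpow_eq_zero_iff_of_nonneg (abs_nonneg _), hp0.ne']

theorem aConst_pos {n : ℕ} {p : ℝ} (hp : 1 ≤ p) : 0 < aConst n p := by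
  unfold aConst
  have h1 : 0 < Real.Gamma (((n : ℝ) + p) / 2) := Real.Gamma_pos_of_pos (by positivity)
  have h2 : 0 < Real.Gamma ((p + 1) / 2) := Real.Gamma_pos_of_pos (by positivity)
  positivity

end LpIso

end

/-! ### The main theorem -/

theorem theorem5p1 (n : ℕ) (hn : 3 ≤ n) (p : ℝ) (hp : 1 ≤ p)
    (e : LpIso.Sph n) (μ : Measure (LpIso.Sph n))
    (hμ_even : LpIso.IsEvenMeasure μ) (hμ_zonal : LpIso.IsZonalMeasure e μ)
    (hμ_mass : μ Set.univ = ENNReal.ofReal (LpIso.aConst n p))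
    (K : ConvexBody (LpIso.Rn n)) (hK : (0 : LpIso.Rn n) ∈ interior (K : Set (LpIso.Rn n))) :
    volume (LpIso.polarBody (LpIso.phiBody p e μ (K : Set (LpIso.Rn n))))
        ≤ volume (LpIso.polarBody (LpIso.lpProjectionBody p (K : Set (LpIso.Rn n)))) ∧
      (volume (LpIso.polarBody (LpIso.phiBody p e μ (K : Set (LpIso.Rn n))))
          = volume (LpIso.polarBody (LpIso.lpProjectionBody p (K : Set (LpIso.Rn n)))) ↔
        (LpIso.IsDiscreteMeasure μ ∨
          LpIso.IsEuclideanBall (LpIso.lpProjectionBody p (K : Set (LpIso.Rn n))))) := by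
  have ha : 0 < LpIso.aConst n p := LpIso.aConst_pos hp
  have : IsFiniteMeasure μ := ⟨by rw [hμ_mass]; exact ENNReal.ofReal_lt_top⟩
  have hμ0 : NeZero μ := ⟨fun h => by
    rw [h, Measure.coe_zero, Pi.zero_apply, eq_comm, ENNReal.ofReal_eq_zero] at hμ_mass
    exact absurd ha (not_lt.2 hμ_mass)⟩
  have hfin := LpIso.isFiniteMeasure_lpSurfaceAreaMeasure p K.isCompact hK
  set ν := LpIso.lpSurfaceAreaMeasure p (K : Set (LpIso.Rn n)) with hν
  have hF : ∀ u : LpIso.Sph n,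
      0 < LpIso.lpCosine p hp ((LpIso.aConst n p).toNNReal • ν) (u : LpIso.Rn n) := by
    intro u
    refine LpIso.lpCosine_pos hp ?_
    rw [Measure.smul_apply, ENNReal.smul_def, smul_eq_mul]
    refine mul_ne_zero (by simpa using ha) fun h => ?_
    exact (LpIso.surfaceAreaMeasure_inner_ne_zero_pos K.isCompact K.convex hK u).ne'
      (LpIso.surfaceAreaMeasure_absolutelyContinuous p K.isCompact hK h)
  rw [LpIso.phiBody_eq hn hp hμ_zonal, LpIso.lpProjectionBody_eq hp _ ha.le,
    LpIso.polarBody_bodyOfSupport, LpIso.polarBody_bodyOfSupport,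
    LpIso.isEuclideanBall_bodyOfSupport_iff _ hF e]
  refine LpIso.volume_le_and_eq_iff hn hp hF (fun ϑ hϑ => ?_) hμ_zonal
  -- The factor `a_{n,p}` in `Π_p K` cancels against the total mass of `μ` in the average.
  rw [LpIso.phiSeminorm_rpow, average_eq, measureReal_def, hμ_mass, ENNReal.toReal_ofReal ha.le,
    smul_eq_mul, ← integral_const_mul]
  refine integral_congr_ae (ae_of_all _ fun w => ?_)
  simp only [LpIso.lpCosine_rpow]
  rw [integral_smul_nnreal_measure, NNReal.smul_def, smul_eq_mul, Real.coe_toNNReal _ ha.le,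
    inv_mul_cancel_left₀ ha.ne']
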